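/- For complex sequences indexed by $\mathbb Z$ put $(a\star b)_\ell=\sum_{\ell'\in\mathbb Z}a_{\ell-\ell'}b_{\ell'}$, and let $a^{\star 1}=a$, $a^{\star(n+1)}=a^{\star n}\star a$. Let $a\in\ell^1(\mathbb Z;\mathbb C)$ be such that, for some $\varepsilon>0$, its Fourier series $F_a(\kappa)=\sum_{\ell\in\mathbb Z}a_\ell\kappa^\ell$ converges and defines a holomorphic function on the annulus $1-\varepsilon<|\kappa|<1+\varepsilon$, and such that $\sup_{|\kappa|=1}|F_a(\kappa)|=1$. Assume that there are $K\ge1$ pairwise distinct points $\kappa_1,\dots,\kappa_K$ of the unit circle with $|F_a(\kappa_k)|=1$ for all $k$ and $|F_a(\kappa)|<1$ at every other point of the unit circle, and that for every $k$ there are $\alpha_k\in\mathbb R$, $\beta_k\in\mathbb C$ with $\mathrm{Re}\,\beta_k>0$ and an integer $\mu_k\ge1$ such that, as the complex number $\xi$ tends to $0$, $$F_a(\kappa_k e^{i\xi})=F_a(\kappa_k)\exp\big(i\alpha_k\xi-\beta_k\xi^{2\mu_k}+O(\xi^{2\mu_k+1})\big).$$ Let the cumulants $\gamma_{k,\nu}$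 be the coefficients of the convergent expansion, for small complex $\xi$, $$F_a(\kappa_k e^{i\xi})=F_a(\kappa_k)\exp\Big(i\alpha_k\xi-\beta_k\xi^{2\mu_k}+\sum_{\nu\ge2\mu_k+1}\frac{\gamma_{k,\nu}}{\nu!}(i\xi)^\nu\Big),$$ let the polynomials $P_{k,m}$, $m\ge1$, be defined by the formal power series identity $$\exp\Big(\sum_{\nu\ge1}\frac{\gamma_{k,2\mu_k+\nu}}{(2\mu_k+\nu)!}Y^{2\mu_k+\nu}Z^\nu\Big)=1+\sum_{m\ge1}P_{k,m}(Y)Z^m,$$ and for $\mu\ge1$ and $\mathrm{Re}\,\beta>0$ let $$H_{2\mu}^{\beta}(x)=\frac1{2\pi}\int_{\mathbb R}e^{-ix\theta}e^{-\beta\theta^{2\mu}}\,d\theta,\qquad x\in\mathbb R.$$ Then there exist an integer $L\ge1$ and a constant $c_0>0$ such that: (i) for all integers $n\ge1$ and $\ell\in\mathbb Z$ with $|\ell|>Ln$, $\;|a^{\star n}_\ell|\le\exp(-c_0n-c_0|\ell|)$; (ii) for every integer $M\ge0$ there exist constants $C_M,c_M>0$ (depending only on $M$ and $a$) such that for all integers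 $n\ge1$ and $\ell\in\mathbb Z$ with $|\ell|\le Ln$, writing $x_k=(\ell-\alpha_kn)/n^{1/(2\mu_k)}$, $$\Big|a^{\star n}_\ell-\sum_{k=1}^K\frac{\kappa_k^{-\ell}F_a(\kappa_k)^n}{n^{1/(2\mu_k)}}H^{\beta_k}_{2\mu_k}(x_k)-\sum_{k=1}^K\sum_{m=1}^M\frac{\kappa_k^{-\ell}F_a(\kappa_k)^n}{n^{(m+1)/(2\mu_k)}}\big(P_{k,m}(-d/dx)H^{\beta_k}_{2\mu_k}\big)(x_k)\Big|\le C_M\sum_{k=1}^K\frac{1}{n^{(M+2)/(2\mu_k)}}\exp\Big(-c_M|x_k|^{\frac{2\mu_k}{2\mu_k-1}}\Big).$$ -/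

import Mathlib

open Filter Topology Asymptotics

noncomputable section

namespace ConvPower

/-- The convolution of two complex sequences indexed by the integers. -/
def conv (a b : ℤ → ℂ) : ℤ → ℂ := fun l => ∑' l' : ℤ, a (l - l') * b l'

/-- The iterated convolution: the first power is `a`, and each further power is the previous
one convolved with `a`. (The zeroth power is the unit sequence; it plays no role below.) -/
def convPow (a : ℤ → ℂ) : ℕ → ℤ → ℂ
  | 0 => Pi.single 0 1
  | 1 => a
  | n + 2 => conv (convPow a (n + 1)) a

/-- The Fourier series of the sequence `a`, at a complex number `z`. -/
def fourierSum (a : ℤ → ℂ) (z : ℂ) : ℂ := ∑' l : ℤ, a l * z ^ l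

/-- `a` is summable, its Fourier series converges and is holomorphic on an annulus around the
unit circle, and the supremum of its modulus on the unit circle is one. -/
structure NormalizedHolomorphic (a : ℤ → ℂ) : Prop where
  mem_l1 : Memℓp a 1
  holomorphic : ∃ ε : ℝ, 0 < ε ∧
    (∀ z : ℂ, 1 - ε < ‖z‖ → ‖z‖ < 1 + ε → Summable fun l : ℤ => a l * z ^ l) ∧
    DifferentiableOn ℂ (fourierSum a) {z : ℂ | 1 - ε < ‖z‖ ∧ ‖z‖ < 1 + ε}
  sup_eq_one : IsLUB ((fun z : ℂ => ‖fourierSum a z‖) '' Metric.sphere (0 : ℂ) 1) 1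

/-- The points `κ k` are pairwise distinct and are exactly the points of the unit circle at which
the Fourier series `F` of `a` has modulus one, and at each of them, as the complex number `ξ`
tends to zero,
`F (κ k * exp (i ξ)) = F (κ k) * exp (i α ξ - β ξ ^ (2 μ) + O (ξ ^ (2 μ + 1)))`,
with `α` real, `Re β > 0` and `μ` a positive integer, all depending on `k`. -/
structure TangencyData (a : ℤ → ℂ) {K : ℕ} (κ : Fin K → ℂ) (α : Fin K → ℝ) (β : Fin K → ℂ)
    (μ : Fin K → ℕ) : Prop where
  one_le : 1 ≤ K
  injective : Function.Injective κ
  norm_point : ∀ k, ‖κ k‖ = 1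
  norm_value : ∀ k, ‖fourierSum a (κ k)‖ = 1
  norm_lt : ∀ z : ℂ, ‖z‖ = 1 → z ∉ Set.range κ → ‖fourierSum a z‖ < 1
  re_pos : ∀ k, 0 < (β k).re
  mu_pos : ∀ k, 0 < μ k
  expansion : ∀ k, ∃ R : ℂ → ℂ, (R =O[𝓝 0] fun ξ : ℂ => ξ ^ (2 * μ k + 1)) ∧
    ∀ᶠ ξ : ℂ in 𝓝 0, fourierSum a (κ k * Complex.exp (Complex.I * ξ)) =
      fourierSum a (κ k) *
        Complex.exp (Complex.I * (α k : ℂ) * ξ - β k * ξ ^ (2 * μ k) + R ξ)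

/-- The attractor `H` attached to `μ` and `β`:
the inverse Fourier transform of `θ ↦ exp (- β θ ^ (2 μ))`. -/
def attractor (μ : ℕ) (β : ℂ) (x : ℝ) : ℂ :=
  (1 / (2 * (Real.pi : ℂ))) *
    ∫ θ : ℝ, Complex.exp (-(Complex.I * (x : ℂ) * (θ : ℂ))) *
      Complex.exp (-(β * (θ : ℂ) ^ (2 * μ)))

/-- The `ν`-th cumulant of `a` at `z`: the number `γ ν` for which `γ ν / ν! * (i ξ) ^ ν` is the
term of degree `ν` in the power series at `ξ = 0` of the logarithm of
`F (z * exp (i ξ)) / F z`. (The quotient is `1` at `ξ = 0`, so that the principal branch is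
analytic there.) -/
def cumulant (a : ℤ → ℂ) (z : ℂ) (ν : ℕ) : ℂ :=
  iteratedDeriv ν
    (fun ξ : ℂ => Complex.log (fourierSum a (z * Complex.exp (Complex.I * ξ)) / fourierSum a z)) 0
    / Complex.I ^ ν

/-- The formal series `∑_{ν ≥ 1} γ (2 μ + ν) / (2 μ + ν)! * Y ^ (2 μ + ν) * Z ^ ν`, as a power
series in `Z` with coefficients in the ring of polynomials in `Y`. -/
def cumulantSeries (γ : ℕ → ℂ) (μ : ℕ) : PowerSeries (Polynomial ℂ) :=
  PowerSeries.mk fun ν =>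
    if ν = 0 then 0
    else Polynomial.monomial (2 * μ + ν) (γ (2 * μ + ν) / (Nat.factorial (2 * μ + ν) : ℂ))

/-- The polynomial `P m`: the coefficient of `Z ^ m` in the exponential of `cumulantSeries`. -/
def correctionPoly (γ : ℕ → ℂ) (μ m : ℕ) : Polynomial ℂ :=
  PowerSeries.coeff m ((PowerSeries.exp ℂ).subst (cumulantSeries γ μ))

/-- The function `P (- d/dx) H`. -/
def applyNegDeriv (P : Polynomial ℂ) (H : ℝ → ℂ) (x : ℝ) : ℂ :=
  P.sum fun j c => c * ((-1) ^ j * iteratedDeriv j H x)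

/-- The rescaled position `(l - α n) / n ^ (1 / (2 μ))`. -/
def rescaled (α : ℝ) (μ n : ℕ) (l : ℤ) : ℝ :=
  ((l : ℝ) - α * (n : ℝ)) / (n : ℝ) ^ (1 / (2 * (μ : ℝ)))

end ConvPower

end

open ConvPower

open ConvPower

/-! Convolution becomes multiplication under the Fourier series, so `convPow a n l` is the mean over
the circle of `F ^ n * z ^ (-l)`. Away from the points `κ k`, compactness gives `|F| ≤ q < 1`, hence
an error of size `q ^ n`; only a small arc around each `κ k` matters.

On such an arc put `N = n ^ (1 / (2 μ))` and `t = I ξ`. After the linear phase is absorbed into `x`,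
the integrand is the attractor's kernel at `N ξ` times `exp ((N t) ^ (2 μ) * g t)`, where `g` has
the expansion `reducedSeries`. Setting `Y = N t`, `Z = 1 / N` in the identity defining the
correction polynomials shows that this factor is `∑_{m ≤ M} N ^ (-m) * P m (N t)` up to `N ^ (-(M +
1))` times a harmless exponential (`exists_norm_exp_sub_correction_le`). Integrated over the whole
line, the polynomial terms are the asserted ones, since `-d/dx` multiplies the kernel by `I θ`
(`applyNegDeriv_attractor`).

The decay in `x` is proved for the remainder alone. It is holomorphic near the arc, so its segment
of integration can be moved to imaginary height of order `y / N`, on the side opposite to the sign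
of `x`, with `y = |x| ^ (1 / (2 μ - 1))` (`exists_norm_integral_le_gaussian`). The tails of the
polynomial terms and the far part of the circle are `O(exp (-c n))`, with `n = N ^ (2 μ)`; for `|l|
≤ L n` one has `y ≤ B N`, and `exists_exp_le_absorb` turns them into errors of the required shape.
For `|l| > L n`, summability with the weights `r ^ l` and `r⁻¹ ^ l` suffices (`exists_cone`). -/

namespace ConvPower

/-! ### Growth of convolution powers in a weighted supremum. -/

/-- The weighted supremum of a convolution power grows at most geometrically. -/
theorem norm_convPow_mul_zpow_le {a : ℤ → ℂ} {r : ℝ} (hr : 0 < r)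
    (hs : Summable fun l : ℤ => ‖a l‖ * r ^ l) {n : ℕ} (hn : 1 ≤ n) (l : ℤ) :
    ‖convPow a n l‖ * r ^ l ≤ (∑' l : ℤ, ‖a l‖ * r ^ l) ^ n := by
  set A := ∑' l : ℤ, ‖a l‖ * r ^ l with hA
  have hA0 : 0 ≤ A := tsum_nonneg fun l => by positivity
  induction n, hn using Nat.le_induction generalizing l with
  | base =>
    simpa [convPow] using hs.le_tsum l (fun j _ => by positivity)
  | succ n hn ih =>
    obtain ⟨m, rfl⟩ : ∃ m, n = m + 1 := ⟨n - 1, by omega⟩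
    have key : ∀ j : ℤ, ‖convPow a (m + 1) (l - j) * a j‖ ≤
        A ^ (m + 1) * (r ^ l)⁻¹ * (‖a j‖ * r ^ j) := fun j => by
      have h := ih (l - j)
      rw [norm_mul]
      -- The weight is a character of the integers, so it splits along `l = (l - j) + j`: the
      -- supremum bound takes one factor, the weighted sum of `a` the other.
      have e : ‖convPow a (m + 1) (l - j)‖ =
          ‖convPow a (m + 1) (l - j)‖ * r ^ (l - j) * ((r ^ l)⁻¹ * r ^ j) := by
        rw [zpow_sub₀ hr.ne']
        have := (zpow_pos hr l).ne'
        have := (zpow_pos hr j).ne'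
        field_simp
      rw [e]
      calc _ ≤ A ^ (m + 1) * ((r ^ l)⁻¹ * r ^ j) * ‖a j‖ := by gcongr
        _ = _ := by ring
    have hS := hs.mul_left (A ^ (m + 1) * (r ^ l)⁻¹)
    have h1 : ‖convPow a (m + 1 + 1) l‖ ≤ A ^ (m + 1) * (r ^ l)⁻¹ * A := by
      have : convPow a (m + 1 + 1) l = ∑' j : ℤ, convPow a (m + 1) (l - j) * a j := rfl
      rw [this, hA, ← tsum_mul_left]
      exact tsum_of_norm_bounded hS.hasSum key
    calc _ ≤ A ^ (m + 1) * (r ^ l)⁻¹ * A * r ^ l := by gcongr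
      _ = A ^ (m + 1 + 1) := by
        have := (zpow_pos hr l).ne'
        field_simp
        ring

/-! ### Fourier series of convolution powers and Fourier inversion. -/

/-- The shear `(l, l') ↦ (l - l', l')` of the integer lattice. -/
def shearEquiv : ℤ × ℤ ≃ ℤ × ℤ where
  toFun p := (p.1 - p.2, p.2)
  invFun p := (p.1 + p.2, p.2)
  left_inv p := by simp
  right_inv p := by simp

theorem summable_norm_conv {a b : ℤ → ℂ} (ha : Summable fun l => ‖a l‖)
    (hb : Summable fun l => ‖b l‖) : Summable fun l => ‖conv a b l‖ := by
  have h := shearEquiv.summable_iff.mpr (ha.mul_norm hb)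
  refine Summable.of_nonneg_of_le (fun _ => norm_nonneg _) (fun l => ?_) h.prod
  exact norm_tsum_le_tsum_norm (h.prod_factor l)

theorem fourierSum_conv {a b : ℤ → ℂ} (ha : Summable fun l => ‖a l‖)
    (hb : Summable fun l => ‖b l‖) {z : ℂ} (hz : ‖z‖ = 1) :
    fourierSum (conv a b) z = fourierSum a z * fourierSum b z := by
  have hz0 : z ≠ 0 := by rintro rfl; simp at hz
  have ha' : Summable fun l : ℤ => ‖a l * z ^ l‖ := by simpa [hz] using ha
  have hb' : Summable fun l : ℤ => ‖b l * z ^ l‖ := by simpa [hz] using hb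
  have h := shearEquiv.summable_iff.mpr (ha'.mul_norm hb').of_norm
  rw [fourierSum, fourierSum, fourierSum, tsum_mul_tsum_of_summable_norm ha' hb',
    ← shearEquiv.tsum_eq]
  refine Eq.trans ?_ (Summable.tsum_prod h).symm
  refine tsum_congr fun l => ?_
  rw [conv, ← tsum_mul_right]
  refine tsum_congr fun j => ?_
  have : z ^ l = z ^ (l - j) * z ^ j := by rw [← zpow_add₀ hz0]; simp
  simp only [Function.comp_apply, shearEquiv, Equiv.coe_fn_mk, this]
  ring

theorem summable_norm_convPow {a : ℤ → ℂ} (ha : Summable fun l => ‖a l‖) {n : ℕ} (hn : 1 ≤ n) :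
    Summable fun l => ‖convPow a n l‖ := by
  induction n, hn using Nat.le_induction with
  | base => simpa [convPow] using ha
  | succ n hn ih =>
    obtain ⟨m, rfl⟩ : ∃ m, n = m + 1 := ⟨n - 1, by omega⟩
    exact summable_norm_conv ih ha

theorem fourierSum_convPow {a : ℤ → ℂ} (ha : Summable fun l => ‖a l‖) {n : ℕ} (hn : 1 ≤ n)
    {z : ℂ} (hz : ‖z‖ = 1) : fourierSum (convPow a n) z = fourierSum a z ^ n := by
  induction n, hn using Nat.le_induction with
  | base => simp [convPow]
  | succ n hn ih =>
    obtain ⟨m, rfl⟩ : ∃ m, n = m + 1 := ⟨n - 1, by omega⟩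
    rw [pow_succ, ← ih]
    exact fourierSum_conv (summable_norm_convPow ha hn) ha hz

theorem integral_exp_int_mul_I (m : ℤ) :
    ∫ θ in (-Real.pi)..Real.pi, Complex.exp (θ * Complex.I) ^ m =
      if m = 0 then 2 * (Real.pi : ℂ) else 0 := by
  split_ifs with h
  · subst h
    simp
    ring
  · have hc : (m : ℂ) * Complex.I ≠ 0 := by simp [h]
    have e : ∀ θ : ℝ, Complex.exp (θ * Complex.I) ^ m = Complex.exp (m * Complex.I * θ) :=
      fun θ => by rw [← Complex.exp_int_mul]; ring_nf
    simp_rw [e]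
    rw [integral_exp_mul_complex hc]
    have : Complex.exp (m * Complex.I * (Real.pi : ℝ)) =
        Complex.exp (m * Complex.I * ((-Real.pi : ℝ) : ℂ)) := by
      rw [Complex.exp_eq_exp_iff_exists_int]
      exact ⟨m, by push_cast; ring⟩
    rw [this]
    simp

/-- Fourier inversion for an absolutely summable sequence. -/
theorem integral_fourierSum_mul_zpow {b : ℤ → ℂ} (hb : Summable fun l => ‖b l‖) (l : ℤ) :
    ∫ θ in (-Real.pi)..Real.pi, fourierSum b (Complex.exp (θ * Complex.I)) *
      Complex.exp (θ * Complex.I) ^ (-l) = 2 * (Real.pi : ℂ) * b l := by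
  have hne : ∀ θ : ℝ, Complex.exp (θ * Complex.I) ≠ 0 := fun θ => Complex.exp_ne_zero _
  have hcont : ∀ j : ℤ, Continuous fun θ : ℝ => b j * Complex.exp (θ * Complex.I) ^ (j - l) :=
    fun j => continuous_const.mul
      (Continuous.zpow₀ (by fun_prop) _ fun θ => Or.inl (hne θ))
  let f : ℤ → C(ℝ, ℂ) := fun j => ⟨_, hcont j⟩
  have hsum : Summable fun j : ℤ =>
      ‖(f j).restrict (⟨Set.uIcc (-Real.pi) Real.pi, isCompact_uIcc⟩ :
        TopologicalSpace.Compacts ℝ)‖ := by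
    refine Summable.of_nonneg_of_le (fun _ => norm_nonneg _) (fun j => ?_) hb
    rw [ContinuousMap.norm_le _ (norm_nonneg _)]
    intro θ
    simp [f, Complex.norm_exp]
  have h := intervalIntegral.hasSum_intervalIntegral_of_summable_norm hsum
  have e : ∀ θ : ℝ, ∑' j, f j θ = fourierSum b (Complex.exp (θ * Complex.I)) *
      Complex.exp (θ * Complex.I) ^ (-l) := fun θ => by
    rw [fourierSum, ← tsum_mul_right]
    refine tsum_congr fun j => ?_
    simp only [f, ContinuousMap.coe_mk]
    rw [mul_assoc, ← zpow_add₀ (hne θ), sub_eq_add_neg]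
  simp_rw [e] at h
  rw [← h.tsum_eq]
  have e2 : ∀ j, ∫ θ in (-Real.pi)..Real.pi, f j θ =
      if j = l then 2 * (Real.pi : ℂ) * b l else 0 := fun j => by
    simp only [f, ContinuousMap.coe_mk]
    rw [intervalIntegral.integral_const_mul, integral_exp_int_mul_I]
    simp only [sub_eq_zero]
    split_ifs with hj
    · rw [hj]; ring
    · simp
  simp_rw [e2, tsum_ite_eq]

theorem integral_fourierSum_pow_mul_zpow {a : ℤ → ℂ} (ha : Summable fun l => ‖a l‖) {n : ℕ}
    (hn : 1 ≤ n) (l : ℤ) :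
    ∫ θ in (-Real.pi)..Real.pi, fourierSum a (Complex.exp (θ * Complex.I)) ^ n *
      Complex.exp (θ * Complex.I) ^ (-l) = 2 * (Real.pi : ℂ) * convPow a n l := by
  rw [← integral_fourierSum_mul_zpow (summable_norm_convPow ha hn) l]
  refine intervalIntegral.integral_congr fun θ _ => ?_
  rw [fourierSum_convPow ha hn (Complex.norm_exp_ofReal_mul_I θ)]

/-! ### Decay outside a cone. -/

theorem summable_norm_mul_zpow {a : ℤ → ℂ} {r : ℝ} (hr : 0 < r)
    (h : Summable fun l : ℤ => a l * (r : ℂ) ^ l) : Summable fun l : ℤ => ‖a l‖ * r ^ l := by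
  refine h.norm.congr fun l => ?_
  simp [abs_of_pos hr]

/-- Exponential decay of the convolution powers outside a cone. -/
theorem exists_cone {a : ℤ → ℂ} {r : ℝ} (hr : 1 < r)
    (h1 : Summable fun l : ℤ => ‖a l‖ * r ^ l) (h2 : Summable fun l : ℤ => ‖a l‖ * r⁻¹ ^ l) :
    ∃ L : ℕ, 0 < L ∧ ∃ c : ℝ, 0 < c ∧ ∀ n : ℕ, 1 ≤ n → ∀ l : ℤ,
      (L : ℝ) * (n : ℝ) < |(l : ℝ)| →
        ‖convPow a n l‖ ≤ Real.exp (-c * (n : ℝ) - c * |(l : ℝ)|) := by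
  have hr0 : 0 < r := by linarith
  set A := max (∑' l : ℤ, ‖a l‖ * r ^ l) (∑' l : ℤ, ‖a l‖ * r⁻¹ ^ l) with hA
  have hs : 0 < Real.log r := Real.log_pos hr
  set s := Real.log r with hs'
  have hrs : ∀ l : ℤ, r ^ l = Real.exp (s * l) := fun l => by
    rw [← Real.rpow_intCast, Real.rpow_def_of_pos hr0]
  have hbd : ∀ n : ℕ, 1 ≤ n → ∀ l : ℤ, ‖convPow a n l‖ * Real.exp (s * |(l : ℝ)|) ≤ A ^ n := by
    intro n hn l
    rcases abs_cases (l : ℝ) with ⟨h, -⟩ | ⟨h, -⟩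
    · rw [h, ← hrs]
      refine (norm_convPow_mul_zpow_le hr0 h1 hn l).trans ?_
      exact pow_le_pow_left₀ (tsum_nonneg fun l => by positivity) (le_max_left _ _) n
    · have : Real.exp (s * -(l : ℝ)) = r⁻¹ ^ l := by
        rw [inv_zpow', hrs]; push_cast; rfl
      rw [h, this]
      refine (norm_convPow_mul_zpow_le (inv_pos.mpr hr0) h2 hn l).trans ?_
      exact pow_le_pow_left₀ (tsum_nonneg fun l => by positivity) (le_max_right _ _) n
  -- The bound obtained is `exp (A n - s |l|)`. Half of `s |l|` must pay for `(A + s / 2) n`, that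
  -- is `s L > 2 A + s`; the other half is the decay in `l`.
  obtain ⟨L, hL⟩ := exists_nat_gt (max 0 (2 * (A + s / 2) / s))
  have hL0 : (0 : ℝ) < L := (le_max_left _ _).trans_lt hL
  have hL1 : 2 * (A + s / 2) / s < L := (le_max_right _ _).trans_lt hL
  refine ⟨L, by exact_mod_cast hL0, s / 2, by positivity, fun n hn l hl => ?_⟩
  have hA0 : 0 ≤ A := le_max_of_le_left (tsum_nonneg fun l => by positivity)
  have hAn : A ^ n ≤ Real.exp (A * n) := by
    rw [mul_comm, Real.exp_nat_mul]
    exact pow_le_pow_left₀ hA0 (by linarith [Real.add_one_le_exp A]) n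
  have h3 := (hbd n hn l).trans hAn
  rw [← le_div_iff₀ (Real.exp_pos _), ← Real.exp_sub] at h3
  refine h3.trans (Real.exp_le_exp.mpr ?_)
  rw [div_lt_iff₀ hs] at hL1
  have hn0 : (0 : ℝ) < n := by exact_mod_cast hn
  nlinarith [mul_lt_mul_of_pos_right hL1 hn0, mul_lt_mul_of_pos_left hl hs]

/-! ### Localization of circle integrals to arcs. -/

/-- Comparison of arc and chord; it is the source of the distance `2 * δ / π` from the centres that
holds off the arcs of half-angle `δ`. -/
theorem abs_arg_le_mul_norm_sub_one {z : ℂ} (hz : ‖z‖ = 1) : |z.arg| ≤ Real.pi / 2 * ‖z - 1‖ := by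
  have h0 : z ≠ 0 := by rintro rfl; simp at hz
  have h := Complex.angle_le_mul_norm_sub hz (norm_one (α := ℂ))
  rwa [Complex.angle_one_right h0] at h

/-- A periodic integral localized to an arc of the unit circle. -/
theorem integral_indicator_arc {κ : ℂ} (hκ : ‖κ‖ = 1) {δ : ℝ} (hδ : 0 < δ) (hδπ : δ < Real.pi)
    (h : ℂ → ℂ) :
    ∫ θ in (-Real.pi)..Real.pi, Set.indicator {z : ℂ | |(z / κ).arg| ≤ δ} h
      (Complex.exp (θ * Complex.I)) = ∫ θ in (-δ)..δ, h (κ * Complex.exp (θ * Complex.I)) := by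
  have hκ0 : κ ≠ 0 := by rintro rfl; simp at hκ
  set g := Set.indicator {z : ℂ | |(z / κ).arg| ≤ δ} h with hg
  have hp : Function.Periodic (fun θ : ℝ => g (Complex.exp (θ * Complex.I))) (2 * Real.pi) := by
    intro θ
    simp only
    congr 1
    push_cast
    rw [add_mul, Complex.exp_add, Complex.exp_two_pi_mul_I, mul_one]
  have hκe : κ = Complex.exp (κ.arg * Complex.I) := by
    conv_lhs => rw [← Complex.norm_mul_exp_arg_mul_I κ, hκ]
    simp
  -- Periodicity allows the window to be centred at `κ.arg`, so that the arc becomes a symmetric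
  -- interval inside the range of `arg`.
  have h1 := hp.intervalIntegral_add_eq (-Real.pi) (-Real.pi + κ.arg)
  rw [show -Real.pi + 2 * Real.pi = Real.pi by ring,
    show -Real.pi + κ.arg + 2 * Real.pi = Real.pi + κ.arg by ring] at h1
  rw [h1, ← intervalIntegral.integral_comp_add_right
    (fun θ : ℝ => g (Complex.exp (θ * Complex.I))) κ.arg]
  have e : ∀ θ : ℝ, Complex.exp (((θ + κ.arg : ℝ) : ℂ) * Complex.I) =
      κ * Complex.exp (θ * Complex.I) := fun θ => by
    conv_rhs => rw [hκe]
    rw [← Complex.exp_add]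
    congr 1
    push_cast
    ring
  simp_rw [e]
  rw [intervalIntegral.integral_of_le (by linarith), intervalIntegral.integral_of_le (by linarith),
    ← MeasureTheory.integral_Icc_eq_integral_Ioc (x := -δ)]
  have e2 : ∀ θ ∈ Set.Ioc (-Real.pi) Real.pi, g (κ * Complex.exp (θ * Complex.I)) =
      Set.indicator (Set.Icc (-δ) δ) (fun θ : ℝ => h (κ * Complex.exp (θ * Complex.I))) θ := by
    intro θ hθ
    have : (κ * Complex.exp (θ * Complex.I) / κ).arg = θ := by
      rw [mul_div_cancel_left₀ _ hκ0, Complex.exp_mul_I]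
      exact Complex.arg_cos_add_sin_mul_I hθ
    simp only [hg, Set.indicator_apply, Set.mem_ofPred_eq, this, Set.mem_Icc, abs_le]
  rw [MeasureTheory.setIntegral_congr_fun measurableSet_Ioc e2,
    MeasureTheory.setIntegral_indicator measurableSet_Icc]
  congr 2
  refine Set.inter_eq_right.mpr fun θ hθ => ⟨by linarith [hθ.1], by linarith [hθ.2]⟩

theorem measurableSet_arc (κ : ℂ) (δ : ℝ) : MeasurableSet {z : ℂ | |(z / κ).arg| ≤ δ} :=
  measurableSet_le (by fun_prop) measurable_const

/-- An integral over the unit circle is the sum of the integrals over small arcs around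
finitely many points, up to the supremum of the integrand away from these points. -/
theorem norm_integral_sub_sum_arcs_le {K : ℕ} {κ : Fin K → ℂ} (hκ : ∀ k, ‖κ k‖ = 1) {δ : ℝ}
    (hδ : 0 < δ) (hδπ : δ < Real.pi) (hsep : ∀ j k, j ≠ k → 2 * δ < ‖κ j - κ k‖)
    {h : ℂ → ℂ} (hc : Continuous fun θ : ℝ => h (Complex.exp (θ * Complex.I))) {q : ℝ}
    (hq : 0 ≤ q)
    (hh : ∀ z : ℂ, ‖z‖ = 1 → (∀ k, 2 * δ / Real.pi ≤ ‖z - κ k‖) → ‖h z‖ ≤ q) :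
    ‖(∫ θ in (-Real.pi)..Real.pi, h (Complex.exp (θ * Complex.I)))
      - ∑ k, ∫ θ in (-δ)..δ, h (κ k * Complex.exp (θ * Complex.I))‖ ≤ 2 * Real.pi * q := by
  have hκ0 : ∀ k, κ k ≠ 0 := fun k h0 => by simpa [h0] using hκ k
  set S : Fin K → Set ℂ := fun k => {z : ℂ | |(z / κ k).arg| ≤ δ} with hS
  have hmexp : Measurable fun θ : ℝ => Complex.exp (θ * Complex.I) := by fun_prop
  have hint : ∀ k, IntervalIntegrable
      (fun θ : ℝ => (S k).indicator h (Complex.exp (θ * Complex.I))) MeasureTheory.volume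
      (-Real.pi) Real.pi := fun k => by
    have h1 := (hc.intervalIntegrable (μ := MeasureTheory.volume) (-Real.pi) Real.pi)
    rw [intervalIntegrable_iff] at h1 ⊢
    exact h1.indicator (hmexp (measurableSet_arc (κ k) δ))
  have h1 : ∀ k, ∫ θ in (-δ)..δ, h (κ k * Complex.exp (θ * Complex.I)) =
      ∫ θ in (-Real.pi)..Real.pi, (S k).indicator h (Complex.exp (θ * Complex.I)) :=
    fun k => (integral_indicator_arc (hκ k) hδ hδπ h).symm
  simp_rw [h1]
  rw [← intervalIntegral.integral_finsetSum fun k _ => hint k,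
    ← intervalIntegral.integral_sub (hc.intervalIntegrable _ _)
      (by
        have := IntervalIntegrable.sum Finset.univ (fun k _ => hint k)
        simpa [Finset.sum_fn] using this)]
  have hle : ∀ θ ∈ Set.uIoc (-Real.pi) Real.pi,
      ‖h (Complex.exp (θ * Complex.I)) -
        ∑ k, (S k).indicator h (Complex.exp (θ * Complex.I))‖ ≤ q := by
    intro θ _
    set z := Complex.exp (θ * Complex.I) with hz
    have hz1 : ‖z‖ = 1 := Complex.norm_exp_ofReal_mul_I θ
    have harc : ∀ k, z ∈ S k → ‖z - κ k‖ ≤ δ := fun k hk => by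
      have hw : ‖z / κ k‖ = 1 := by rw [norm_div, hz1, hκ k, div_one]
      have hw2 : z / κ k = Complex.exp ((z / κ k).arg * Complex.I) := by
        conv_lhs => rw [← Complex.norm_mul_exp_arg_mul_I (z / κ k), hw]
        simp
      have : z - κ k = κ k * (z / κ k - 1) := by field_simp [hκ0 k]
      rw [this, norm_mul, hκ k, one_mul, hw2]
      have h3 := Real.norm_exp_I_mul_ofReal_sub_one_le (x := (z / κ k).arg)
      rw [mul_comm] at h3
      exact h3.trans hk
    -- A point on two arcs would put their centres within `2 * δ`. So on an arc exactly one
    -- indicator survives and cancels `h`; off the arcs only `h` remains.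
    by_cases hex : ∃ k, z ∈ S k
    · obtain ⟨k, hk⟩ := hex
      rw [Finset.sum_eq_single k, Set.indicator_of_mem hk, sub_self, norm_zero]
      · exact hq
      · intro j _ hjk
        refine Set.indicator_of_notMem (fun hj => ?_) _
        have h4 := hsep j k hjk
        have : κ j - κ k = (z - κ k) - (z - κ j) := by ring
        have h5 : ‖κ j - κ k‖ ≤ ‖z - κ k‖ + ‖z - κ j‖ := by rw [this]; exact norm_sub_le _ _
        linarith [harc k hk, harc j hj]
      · simp
    · push Not at hex
      rw [Finset.sum_eq_zero fun k _ => Set.indicator_of_notMem (hex k) _, sub_zero]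
      refine hh z hz1 fun k => ?_
      have h6 := hex k
      simp only [hS, Set.mem_ofPred_eq, not_le] at h6
      have hw : ‖z / κ k‖ = 1 := by rw [norm_div, hz1, hκ k, div_one]
      have h7 := abs_arg_le_mul_norm_sub_one hw
      have : z - κ k = κ k * (z / κ k - 1) := by field_simp [hκ0 k]
      rw [this, norm_mul, hκ k, one_mul, div_le_iff₀ Real.pi_pos]
      linarith
  refine (intervalIntegral.norm_integral_le_of_norm_le_const hle).trans (le_of_eq ?_)
  rw [abs_of_nonneg (by linarith [Real.pi_pos])]
  ring

/-! ### Asymptotic expansions in powers of the variable -/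

/-- The power series `p` is an asymptotic expansion of `g` at `0`. -/
def HasExpansion (g : ℂ → ℂ) (p : PowerSeries ℂ) : Prop :=
  ∀ M : ℕ, (fun t => g t - (PowerSeries.trunc M p).eval t) =O[𝓝 0] fun t : ℂ => t ^ M

theorem isBigO_eval_of_X_pow_dvd {q : Polynomial ℂ} {M : ℕ} (h : Polynomial.X ^ M ∣ q) :
    (fun t => q.eval t) =O[𝓝 0] fun t : ℂ => t ^ M := by
  obtain ⟨r, rfl⟩ := h
  have h1 : (fun t : ℂ => r.eval t) =O[𝓝 0] fun _ => (1 : ℂ) :=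
    (r.continuous.tendsto 0).isBigO_one ℂ
  simpa using (isBigO_refl (fun t : ℂ => t ^ M) (𝓝 0)).mul h1

theorem HasExpansion.isBigO_one {g : ℂ → ℂ} {p : PowerSeries ℂ} (h : HasExpansion g p) :
    g =O[𝓝 0] fun _ => (1 : ℂ) := by
  simpa using h 0

theorem HasExpansion.one : HasExpansion (fun _ => 1) 1 := by
  intro M
  rcases M with _ | M
  · simpa using isBigO_refl (fun _ : ℂ => (1 : ℂ)) (𝓝 0)
  · have : ∀ t : ℂ, (1 : ℂ) - (PowerSeries.trunc (M + 1) (1 : PowerSeries ℂ)).eval t = 0 := by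
      intro t
      rw [PowerSeries.trunc_one]
      simp
    simp_rw [this]
    exact isBigO_zero _ _

/-- `g₁ g₂ - T = (g₁ - T₁) g₂ + T₁ (g₂ - T₂) + (T₁ T₂ - T)`, and the last polynomial is divisible by
`X ^ M`. -/
theorem HasExpansion.mul {g₁ g₂ : ℂ → ℂ} {p₁ p₂ : PowerSeries ℂ} (h₁ : HasExpansion g₁ p₁)
    (h₂ : HasExpansion g₂ p₂) : HasExpansion (fun t => g₁ t * g₂ t) (p₁ * p₂) := by
  intro M
  set T₁ := PowerSeries.trunc M p₁
  set T₂ := PowerSeries.trunc M p₂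
  set T := PowerSeries.trunc M (p₁ * p₂)
  have hT : (fun t => (T₁ * T₂ - T).eval t) =O[𝓝 0] fun t : ℂ => t ^ M := by
    refine isBigO_eval_of_X_pow_dvd (Polynomial.X_pow_dvd_iff.mpr fun d hd => ?_)
    rw [Polynomial.coeff_sub, sub_eq_zero, PowerSeries.coeff_trunc, if_pos hd,
      PowerSeries.coeff_mul, Polynomial.coeff_mul]
    refine Finset.sum_congr rfl fun x hx => ?_
    have := Finset.HasAntidiagonal.mem_antidiagonal.mp hx
    rw [PowerSeries.coeff_trunc, PowerSeries.coeff_trunc, if_pos (by omega), if_pos (by omega)]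
  have hT₁ : (fun t => T₁.eval t) =O[𝓝 0] fun _ => (1 : ℂ) :=
    (T₁.continuous.tendsto 0).isBigO_one ℂ
  have ha := (h₁ M).mul h₂.isBigO_one
  have hb := hT₁.mul (h₂ M)
  simp only [mul_one, one_mul] at ha hb
  refine ((ha.add hb).add hT).congr_left fun t => ?_
  simp only [Polynomial.eval_sub, Polynomial.eval_mul]
  ring

theorem HasExpansion.pow {g : ℂ → ℂ} {p : PowerSeries ℂ} (h : HasExpansion g p) (j : ℕ) :
    HasExpansion (fun t => g t ^ j) (p ^ j) := by
  induction j with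
  | zero => simpa using HasExpansion.one
  | succ j ih => simpa only [pow_succ] using ih.mul h

/-- Uniqueness of expansions: the limit at `0` kills the constant term, and dividing by `t` lowers
the order by one, whence the punctured neighbourhood. -/
theorem coeff_eq_zero_of_isBigO {k : ℕ} {q : Polynomial ℂ}
    (h : (fun t => q.eval t) =O[𝓝[≠] 0] fun t : ℂ => t ^ k) : ∀ i < k, q.coeff i = 0 := by
  induction k generalizing q with
  | zero => simp
  | succ k ih =>
    have h0 : q.coeff 0 = 0 := by
      have h1 : Tendsto (fun t : ℂ => t ^ (k + 1)) (𝓝[≠] 0) (𝓝 0) := by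
        have : Tendsto (fun t : ℂ => t ^ (k + 1)) (𝓝 0) (𝓝 (0 ^ (k + 1))) :=
          (continuous_pow (k + 1)).tendsto 0
        rw [zero_pow (Nat.succ_ne_zero k)] at this
        exact this.mono_left nhdsWithin_le_nhds
      have h2 := h.trans_tendsto h1
      have h3 : Tendsto (fun t => q.eval t) (𝓝[≠] 0) (𝓝 (q.eval 0)) :=
        (q.continuous.tendsto 0).mono_left nhdsWithin_le_nhds
      rw [Polynomial.coeff_zero_eq_eval_zero]
      exact tendsto_nhds_unique h3 h2
    obtain ⟨r, rfl⟩ := Polynomial.X_dvd_iff.mpr h0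
    have h4 : (fun t => r.eval t) =O[𝓝[≠] 0] fun t : ℂ => t ^ k := by
      have h5 := (isBigO_refl (fun t : ℂ => t⁻¹) (𝓝[≠] 0)).mul h
      refine h5.congr' ?_ ?_
      · filter_upwards [self_mem_nhdsWithin] with t ht
        have : t ≠ 0 := ht
        simp [this]
      · filter_upwards [self_mem_nhdsWithin] with t ht
        have : t ≠ 0 := ht
        rw [pow_succ]
        field_simp
    intro i hi
    rcases i with _ | i
    · exact h0
    · rw [Polynomial.coeff_X_mul]
      exact ih h4 i (by omega)

/-! ### The correction polynomials -/

/-- The series `∑_{ν ≥ 1} γ (2 μ + ν) / (2 μ + ν)! * t ^ ν`. -/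
noncomputable def reducedSeries (γ : ℕ → ℂ) (μ : ℕ) : PowerSeries ℂ :=
  PowerSeries.mk fun ν => if ν = 0 then 0 else γ (2 * μ + ν) / (Nat.factorial (2 * μ + ν) : ℂ)

/-- In each term the degree in `Y` exceeds that in `Z` by `2 * μ`, so `y ^ (2 * μ)` factors out and
the rest depends on `y Z` only. -/
theorem map_eval_cumulantSeries (γ : ℕ → ℂ) (μ : ℕ) (y : ℂ) :
    PowerSeries.map (Polynomial.evalRingHom y) (cumulantSeries γ μ) =
      PowerSeries.C (y ^ (2 * μ)) * PowerSeries.rescale y (reducedSeries γ μ) := by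
  ext ν
  rw [PowerSeries.coeff_map, PowerSeries.coeff_C_mul, PowerSeries.coeff_rescale, cumulantSeries,
    reducedSeries, PowerSeries.coeff_mk, PowerSeries.coeff_mk]
  split_ifs
  · simp
  · simp [Polynomial.eval_monomial, pow_add]
    ring

/-- `cumulantSeries` has no constant term, so its `j`-th power starts at `Z ^ j` and the terms `j >
m` vanish. Any cut `M ≥ m` is allowed, in order that all `m ≤ M` may share one. -/
theorem eval_correctionPoly (γ : ℕ → ℂ) (μ : ℕ) {m M : ℕ} (hm : m ≤ M) (y : ℂ) :
    (correctionPoly γ μ m).eval y = ∑ j ∈ Finset.range (M + 1),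
      (y ^ (2 * μ)) ^ j / (j.factorial : ℂ) *
        (y ^ m * PowerSeries.coeff m (reducedSeries γ μ ^ j)) := by
  have hc : PowerSeries.constantCoeff (cumulantSeries γ μ) = 0 := by
    rw [← PowerSeries.coeff_zero_eq_constantCoeff_apply, cumulantSeries, PowerSeries.coeff_mk]
    simp
  rw [correctionPoly, PowerSeries.coeff_subst' (.of_constantCoeff_zero' hc)]
  rw [finsum_eq_sum_of_support_subset (s := Finset.range (M + 1))]
  · rw [Polynomial.eval_finsetSum]
    refine Finset.sum_congr rfl fun j _ => ?_
    have h1 : (PowerSeries.coeff m (cumulantSeries γ μ ^ j)).eval y =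
        (y ^ (2 * μ)) ^ j * (y ^ m * PowerSeries.coeff m (reducedSeries γ μ ^ j)) := by
      rw [← Polynomial.coe_evalRingHom, ← PowerSeries.coeff_map, map_pow,
        map_eval_cumulantSeries, mul_pow, ← map_pow, ← map_pow, PowerSeries.coeff_C_mul,
        PowerSeries.coeff_rescale]
    rw [Polynomial.eval_smul, h1, PowerSeries.coeff_exp]
    simp
    ring
  · intro j hj
    by_contra hj'
    apply hj
    have hlt : m < j := by
      simp at hj'
      omega
    have hd : PowerSeries.X ^ j ∣ cumulantSeries γ μ ^ j :=
      pow_dvd_pow_of_dvd (PowerSeries.X_dvd_iff.mpr hc) j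
    simp only
    rw [PowerSeries.X_pow_dvd_iff.mp hd m hlt, smul_zero]

theorem eval_trunc (p : PowerSeries ℂ) (M : ℕ) (t : ℂ) :
    (PowerSeries.trunc M p).eval t =
      ∑ m ∈ Finset.range M, PowerSeries.coeff m p * t ^ m :=
  PowerSeries.eval₂_trunc_eq_sum_range t (RingHom.id ℂ) M p

/-- The substitution `Y = N t`, `Z = 1 / N`. As `Y Z = t`, truncating in `Z` amounts to truncating
the powers of `reducedSeries` in `t`, with `(N t) ^ (2 * μ)` kept exact. -/
theorem sum_eval_correctionPoly (γ : ℕ → ℂ) (μ M : ℕ) {N : ℂ} (hN : N ≠ 0) (t : ℂ) :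
    ∑ m ∈ Finset.range (M + 1), (N ^ m)⁻¹ * (correctionPoly γ μ m).eval (N * t) =
      ∑ j ∈ Finset.range (M + 1), ((N * t) ^ (2 * μ)) ^ j / (j.factorial : ℂ) *
        (PowerSeries.trunc (M + 1) (reducedSeries γ μ ^ j)).eval t := by
  have h : ∀ m ∈ Finset.range (M + 1), (N ^ m)⁻¹ * (correctionPoly γ μ m).eval (N * t) =
      ∑ j ∈ Finset.range (M + 1), ((N * t) ^ (2 * μ)) ^ j / (j.factorial : ℂ) *
        (PowerSeries.coeff m (reducedSeries γ μ ^ j) * t ^ m) := fun m hm => by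
    rw [eval_correctionPoly γ μ (Nat.lt_succ_iff.mp (Finset.mem_range.mp hm)), Finset.mul_sum]
    refine Finset.sum_congr rfl fun j _ => ?_
    rw [mul_pow N t m]
    have : N ^ m ≠ 0 := pow_ne_zero _ hN
    field_simp
  rw [Finset.sum_congr rfl h, Finset.sum_comm]
  refine Finset.sum_congr rfl fun j _ => ?_
  rw [eval_trunc, Finset.mul_sum]

theorem correctionPoly_zero (γ : ℕ → ℂ) (μ : ℕ) : correctionPoly γ μ 0 = 1 := by
  refine Polynomial.funext fun y => ?_
  rw [eval_correctionPoly γ μ le_rfl]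
  simp

/-! ### Powers are dominated by exponentials -/

theorem exists_pow_le_exp (k : ℕ) {ε : ℝ} (hε : 0 < ε) :
    ∃ C : ℝ, 0 < C ∧ ∀ σ : ℝ, 0 ≤ σ → σ ^ k ≤ C * Real.exp (ε * σ) := by
  refine ⟨k.factorial / ε ^ k, by positivity, fun σ hσ => ?_⟩
  have h := Real.pow_div_factorial_le_exp (ε * σ) (by positivity) k
  rw [mul_pow, div_le_iff₀ (by positivity)] at h
  rw [div_mul_eq_mul_div, le_div_iff₀ (by positivity)]
  linarith

theorem exists_pow_le_exp_pow (k : ℕ) {p : ℕ} (hp : p ≠ 0) {ε : ℝ} (hε : 0 < ε) :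
    ∃ C : ℝ, 0 < C ∧ ∀ u : ℝ, 0 ≤ u → u ^ k ≤ C * Real.exp (ε * u ^ p) := by
  obtain ⟨C, hC, h⟩ := exists_pow_le_exp k hε
  refine ⟨C * Real.exp ε, by positivity, fun u hu => ?_⟩
  have hu1 : u ≤ 1 + u ^ p := by
    rcases le_total u 1 with h1 | h1
    · linarith [pow_nonneg hu p]
    · linarith [le_self_pow₀ h1 hp]
  calc u ^ k ≤ (1 + u ^ p) ^ k := pow_le_pow_left₀ hu hu1 k
    _ ≤ C * Real.exp (ε * (1 + u ^ p)) := h _ (by positivity)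
    _ = C * Real.exp ε * Real.exp (ε * u ^ p) := by
      rw [mul_assoc, ← Real.exp_add]; ring_nf

/-! ### Expansion of the exponential of the remainder -/

/-- With `t = I ξ` and `s = (N t) ^ (2 μ)` the exponent is `s * g t`, where `g t = O(t)`. Two errors
arise: cutting the exponential series at order `M`, and truncating `g ^ j`. Each is `|ξ| ^ (M + 1)`
times a power of `|s|` and an exponential, and `|ξ| ^ (M + 1) = N ^ (-(M + 1)) * (N |ξ|) ^ (M + 1)`.
The estimate is uniform in `N`. -/
theorem exists_norm_exp_sub_correction_le {μ : ℕ} (hμ : 0 < μ) {γ : ℕ → ℂ} {R g : ℂ → ℂ}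
    (hg : HasExpansion g (reducedSeries γ μ))
    (hR : ∀ᶠ ξ in 𝓝 (0 : ℂ), R ξ = (Complex.I * ξ) ^ (2 * μ) * g (Complex.I * ξ)) (M : ℕ)
    {ε : ℝ} (hε : 0 < ε) :
    ∃ δ₀ : ℝ, 0 < δ₀ ∧ ∃ C : ℝ, 0 < C ∧ ∀ N : ℝ, 0 < N → ∀ ξ : ℂ, ‖ξ‖ ≤ δ₀ →
      ‖Complex.exp ((N : ℂ) ^ (2 * μ) * R ξ) - ∑ m ∈ Finset.range (M + 1),
        ((N : ℂ) ^ m)⁻¹ * (correctionPoly γ μ m).eval (N * (Complex.I * ξ))‖ ≤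
      C * (N ^ (M + 1))⁻¹ * Real.exp (ε * (N * ‖ξ‖) ^ (2 * μ)) := by
  have hI : Tendsto (fun ξ : ℂ => Complex.I * ξ) (𝓝 0) (𝓝 0) := by
    have : Tendsto (fun ξ : ℂ => Complex.I * ξ) (𝓝 0) (𝓝 (Complex.I * 0)) :=
      (continuous_const_mul Complex.I).tendsto 0
    rwa [mul_zero] at this
  have hg1 : g =O[𝓝 0] fun t : ℂ => t := by
    have := hg 1
    simpa [reducedSeries, eval_trunc] using this
  obtain ⟨C₁, hC₁, hg1⟩ := hg1.exists_pos
  have hpow : ∀ j : ℕ, ∃ A : ℝ, 0 < A ∧ ∀ᶠ t in 𝓝 (0 : ℂ),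
      ‖g t ^ j - (PowerSeries.trunc (M + 1) (reducedSeries γ μ ^ j)).eval t‖ ≤
        A * ‖t ^ (M + 1)‖ := fun j => by
    obtain ⟨A, hA, h⟩ := ((hg.pow j) (M + 1)).exists_pos
    exact ⟨A, hA, h.bound⟩
  choose A hA hAb using hpow
  have hall : ∀ᶠ t in 𝓝 (0 : ℂ), ‖g t‖ ≤ C₁ * ‖t‖ ∧ (∀ j ∈ Finset.range (M + 1),
      ‖g t ^ j - (PowerSeries.trunc (M + 1) (reducedSeries γ μ ^ j)).eval t‖ ≤
        A j * ‖t ^ (M + 1)‖) :=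
    hg1.bound.and ((Finset.eventually_all _).mpr fun j _ => hAb j)
  obtain ⟨δ₁, hδ₁, hball⟩ := Metric.eventually_nhds_iff.mp (hR.and (hI.eventually hall))
  -- The allowance `ε` is shared out: a quarter for powers of `σ = ‖s‖`, a quarter for `exp ‖s * g
  -- t‖`, and a half for `(N ‖ξ‖) ^ (M + 1)`.
  choose B hB hBb using fun k : ℕ => exists_pow_le_exp k (show 0 < ε / 4 by linarith)
  obtain ⟨D, hD, hDb⟩ := exists_pow_le_exp_pow (M + 1) (show 2 * μ ≠ 0 by omega)
    (show 0 < ε / 2 by linarith)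
  set E := B (M + 1) * C₁ ^ (M + 1) + ∑ j ∈ Finset.range (M + 1), B j * A j with hE
  have hE0 : 0 < E := by
    have : 0 ≤ ∑ j ∈ Finset.range (M + 1), B j * A j :=
      Finset.sum_nonneg fun j _ => (mul_pos (hB j) (hA j)).le
    have : 0 < B (M + 1) * C₁ ^ (M + 1) := mul_pos (hB _) (pow_pos hC₁ _)
    linarith
  -- The second bound gives `‖g t‖ ≤ ε / 4`, hence `‖s * g t‖ ≤ ε / 4 * σ`.
  refine ⟨min (δ₁ / 2) (ε / (4 * C₁)), by positivity, E * D, by positivity,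
    fun N hN ξ hξ => ?_⟩
  obtain ⟨hRξ, hgξ, hAξ⟩ := hball (y := ξ) (by
    rw [dist_zero_right]
    have := hξ.trans (min_le_left _ _)
    linarith)
  have hξ2 : C₁ * ‖ξ‖ ≤ ε / 4 := by
    have := hξ.trans (min_le_right _ _)
    rw [le_div_iff₀ (by positivity)] at this
    linarith
  have hNc : (N : ℂ) ≠ 0 := by exact_mod_cast hN.ne'
  rw [sum_eval_correctionPoly γ μ M hNc, hRξ]
  set t := Complex.I * ξ with ht
  have htξ : ‖t‖ = ‖ξ‖ := by simp [ht]
  set s := ((N : ℂ) * t) ^ (2 * μ) with hs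
  set σ := (N * ‖ξ‖) ^ (2 * μ) with hσ
  have hsσ : ‖s‖ = σ := by rw [hs, norm_pow, norm_mul, htξ, Complex.norm_of_nonneg hN.le]
  have hσ0 : 0 ≤ σ := by positivity
  have hst : (N : ℂ) ^ (2 * μ) * (t ^ (2 * μ) * g t) = s * g t := by rw [hs, mul_pow]; ring
  rw [hst]
  rw [htξ] at hgξ
  have hsg : ‖s * g t‖ ≤ ε / 4 * σ := by
    rw [norm_mul, hsσ, mul_comm]
    exact mul_le_mul_of_nonneg_right (hgξ.trans hξ2) hσ0
  have h1 : ‖Complex.exp (s * g t) - ∑ j ∈ Finset.range (M + 1),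
      (s * g t) ^ j / (j.factorial : ℂ)‖ ≤
      B (M + 1) * C₁ ^ (M + 1) * (‖ξ‖ ^ (M + 1) * Real.exp (ε / 2 * σ)) := by
    refine (Complex.norm_exp_sub_sum_le_norm_mul_exp _ _).trans ?_
    calc ‖s * g t‖ ^ (M + 1) * Real.exp ‖s * g t‖
        ≤ (σ * (C₁ * ‖ξ‖)) ^ (M + 1) * Real.exp (ε / 4 * σ) := by
          refine mul_le_mul ?_ (Real.exp_le_exp.mpr hsg) (Real.exp_pos _).le (by positivity)
          rw [norm_mul, hsσ]
          gcongr
      _ = σ ^ (M + 1) * (C₁ ^ (M + 1) * ‖ξ‖ ^ (M + 1) * Real.exp (ε / 4 * σ)) := by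
          rw [mul_pow, mul_pow]; ring
      _ ≤ (B (M + 1) * Real.exp (ε / 4 * σ)) *
          (C₁ ^ (M + 1) * ‖ξ‖ ^ (M + 1) * Real.exp (ε / 4 * σ)) := by
          gcongr
          exact hBb _ _ hσ0
      _ = _ := by
          rw [show ε / 2 * σ = ε / 4 * σ + ε / 4 * σ by ring, Real.exp_add]; ring
  have h2 : ‖∑ j ∈ Finset.range (M + 1), (s * g t) ^ j / (j.factorial : ℂ) -
      ∑ j ∈ Finset.range (M + 1), s ^ j / (j.factorial : ℂ) *
        (PowerSeries.trunc (M + 1) (reducedSeries γ μ ^ j)).eval t‖ ≤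
      (∑ j ∈ Finset.range (M + 1), B j * A j) * (‖ξ‖ ^ (M + 1) * Real.exp (ε / 2 * σ)) := by
    rw [← Finset.sum_sub_distrib, Finset.sum_mul]
    refine norm_sum_le_of_le _ fun j hj => ?_
    have e : (s * g t) ^ j / (j.factorial : ℂ) - s ^ j / (j.factorial : ℂ) *
        (PowerSeries.trunc (M + 1) (reducedSeries γ μ ^ j)).eval t =
        s ^ j / (j.factorial : ℂ) *
        (g t ^ j - (PowerSeries.trunc (M + 1) (reducedSeries γ μ ^ j)).eval t) := by
      rw [mul_pow]; ring
    have h3 := hAξ j hj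
    rw [norm_pow, htξ] at h3
    rw [e, norm_mul, norm_div, norm_pow, hsσ, Complex.norm_natCast]
    calc σ ^ j / j.factorial * _ ≤ σ ^ j * (A j * ‖ξ‖ ^ (M + 1)) := by
          refine mul_le_mul (div_le_self (by positivity) ?_) h3 (norm_nonneg _) (by positivity)
          exact_mod_cast Nat.one_le_iff_ne_zero.mpr (Nat.factorial_ne_zero j)
      _ ≤ (B j * Real.exp (ε / 2 * σ)) * (A j * ‖ξ‖ ^ (M + 1)) := by
          refine mul_le_mul_of_nonneg_right ((hBb j σ hσ0).trans ?_)
            (mul_nonneg (hA j).le (by positivity))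
          refine mul_le_mul_of_nonneg_left (Real.exp_le_exp.mpr ?_) (hB j).le
          nlinarith
      _ = _ := by ring
  have h3 : ‖ξ‖ ^ (M + 1) ≤ (N ^ (M + 1))⁻¹ * (D * Real.exp (ε / 2 * σ)) := by
    have := hDb (N * ‖ξ‖) (by positivity)
    rw [mul_pow] at this
    rw [inv_mul_eq_div, le_div_iff₀ (by positivity)]
    linarith
  have e3 : ∀ x y z : ℂ, x - z = (x - y) + (y - z) := fun x y z => by ring
  rw [e3 _ (∑ j ∈ Finset.range (M + 1), (s * g t) ^ j / (j.factorial : ℂ)) _]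
  refine (norm_add_le_of_le h1 h2).trans ?_
  rw [← add_mul, ← hE]
  calc E * (‖ξ‖ ^ (M + 1) * Real.exp (ε / 2 * σ))
      ≤ E * ((N ^ (M + 1))⁻¹ * (D * Real.exp (ε / 2 * σ)) * Real.exp (ε / 2 * σ)) := by gcongr
    _ = _ := by
      rw [show ε * σ = ε / 2 * σ + ε / 2 * σ by ring, Real.exp_add]; ring

/-! ### The logarithm and its cumulants -/

/-- In the variable `t = I ξ`, that is `ξ = -I t`, the Taylor coefficients of the logarithm become
cumulants over factorials. -/
theorem isBigO_sub_taylor {G : ℂ → ℂ} (hG : AnalyticAt ℂ G 0) (J : ℕ) :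
    (fun t : ℂ => G (-Complex.I * t) - ∑ ν ∈ Finset.range J,
      iteratedDeriv ν G 0 / Complex.I ^ ν / (ν.factorial : ℂ) * t ^ ν) =O[𝓝 0]
      fun t : ℂ => t ^ J := by
  have h := hG.hasFPowerSeriesAt.isBigO_sub_partialSum_pow J
  have hI : Tendsto (fun t : ℂ => -Complex.I * t) (𝓝 0) (𝓝 0) := by
    have : Tendsto (fun ξ : ℂ => -Complex.I * ξ) (𝓝 0) (𝓝 (-Complex.I * 0)) :=
      (continuous_const_mul (-Complex.I)).tendsto 0
    rwa [mul_zero] at this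
  have h2 := h.comp_tendsto hI
  refine IsBigO.congr' (h2.trans (isBigO_of_le _ (g := fun t : ℂ => t ^ J) fun t => ?_))
    (Eventually.of_forall fun t => ?_) EventuallyEq.rfl
  · simp
  · simp only [Function.comp_apply, zero_add, FormalMultilinearSeries.partialSum]
    congr 1
    refine Finset.sum_congr rfl fun ν _ => ?_
    rw [FormalMultilinearSeries.ofScalars_apply_eq, smul_eq_mul, mul_pow,
      show -Complex.I = Complex.I⁻¹ by simp, inv_pow]
    field_simp

/-- The given remainder is only known to be `O(ξ ^ (2 μ + 1))`; it is replaced by the analytic one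
read off from `log f`. Uniqueness of expansions then identifies the terms of `log f` up to degree `2
μ`, and the higher ones divided by `t ^ (2 μ)` form the expansion of `g`. -/
theorem exists_log_remainder {μ : ℕ} (hμ : 0 < μ) {f : ℂ → ℂ} (hf : AnalyticAt ℂ f 0)
    (hf0 : f 0 = 1) {α β : ℂ}
    (hexp : ∃ R : ℂ → ℂ, (R =O[𝓝 0] fun ξ : ℂ => ξ ^ (2 * μ + 1)) ∧ ∀ᶠ ξ : ℂ in 𝓝 0,
      f ξ = Complex.exp (Complex.I * α * ξ - β * ξ ^ (2 * μ) + R ξ)) :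
    ∃ R g : ℂ → ℂ, AnalyticAt ℂ R 0 ∧
      HasExpansion g (reducedSeries
        (fun ν => iteratedDeriv ν (fun ξ => Complex.log (f ξ)) 0 / Complex.I ^ ν) μ) ∧
      (∀ᶠ ξ in 𝓝 (0 : ℂ), R ξ = (Complex.I * ξ) ^ (2 * μ) * g (Complex.I * ξ)) ∧
      ∀ᶠ ξ : ℂ in 𝓝 0, f ξ = Complex.exp (Complex.I * α * ξ - β * ξ ^ (2 * μ) + R ξ) := by
  set G : ℂ → ℂ := fun ξ => Complex.log (f ξ) with hGdef
  set γ : ℕ → ℂ := fun ν => iteratedDeriv ν G 0 / Complex.I ^ ν with hγ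
  have hG : AnalyticAt ℂ G 0 := hf.clog (by rw [hf0]; exact Complex.one_mem_slitPlane)
  set R : ℂ → ℂ := fun ξ => G ξ - Complex.I * α * ξ + β * ξ ^ (2 * μ) with hR
  have hRan : AnalyticAt ℂ R 0 := by
    refine (hG.sub (by fun_prop)).add (by fun_prop)
  obtain ⟨R₀, hR₀O, hR₀⟩ := hexp
  have hR₀0 : Tendsto R₀ (𝓝 0) (𝓝 0) := by
    refine hR₀O.trans_tendsto ?_
    have : Tendsto (fun t : ℂ => t ^ (2 * μ + 1)) (𝓝 0) (𝓝 (0 ^ (2 * μ + 1))) :=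
      (continuous_pow _).tendsto 0
    rwa [zero_pow (by omega)] at this
  -- The exponent tends to `0`, so its imaginary part stays within the principal branch and `log`
  -- inverts `exp`.
  have hRR₀ : ∀ᶠ ξ in 𝓝 (0 : ℂ), R ξ = R₀ ξ := by
    have hlim : Tendsto (fun ξ : ℂ => Complex.I * α * ξ - β * ξ ^ (2 * μ) + R₀ ξ) (𝓝 0) (𝓝 0) := by
      have h1 : Tendsto (fun ξ : ℂ => Complex.I * α * ξ - β * ξ ^ (2 * μ)) (𝓝 0)
          (𝓝 (Complex.I * α * 0 - β * 0 ^ (2 * μ))) :=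
        (Continuous.tendsto (by fun_prop) 0)
      rw [zero_pow (by omega)] at h1
      simpa using h1.add hR₀0
    filter_upwards [hR₀, hlim.eventually (Metric.ball_mem_nhds 0 (Real.pi_pos))] with ξ h1 h2
    have h3 : |(Complex.I * α * ξ - β * ξ ^ (2 * μ) + R₀ ξ).im| < Real.pi :=
      (Complex.abs_im_le_norm _).trans_lt (by simpa using h2)
    simp only [hR, hGdef]
    rw [h1, Complex.log_exp (abs_lt.mp h3).1 (abs_lt.mp h3).2.le]
    ring
  have hRO : R =O[𝓝 0] fun ξ : ℂ => ξ ^ (2 * μ + 1) :=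
    hR₀O.congr' (hRR₀.mono fun _ h => h.symm) EventuallyEq.rfl
  have hI : Tendsto (fun t : ℂ => -Complex.I * t) (𝓝 0) (𝓝 0) := by
    have : Tendsto (fun ξ : ℂ => -Complex.I * ξ) (𝓝 0) (𝓝 (-Complex.I * 0)) :=
      (continuous_const_mul (-Complex.I)).tendsto 0
    rwa [mul_zero] at this
  have hRI : (fun t : ℂ => R (-Complex.I * t)) =O[𝓝 0] fun t : ℂ => t ^ (2 * μ + 1) :=
    (hRO.comp_tendsto hI).trans (isBigO_of_le _ fun t => by simp)
  let q : ℕ → ℂ → ℂ := fun J t => ∑ ν ∈ Finset.range J, γ ν / (ν.factorial : ℂ) * t ^ ν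
  have hq : ∀ J, (fun t : ℂ => G (-Complex.I * t) - q J t) =O[𝓝 0] fun t : ℂ => t ^ J :=
    fun J => isBigO_sub_taylor hG J
  -- The difference of the two sides is a polynomial of degree at most `2 * μ` that is `O(t ^ (2 * μ
  -- + 1))`, hence zero.
  have hlow : ∀ t : ℂ, q (2 * μ + 1) t =
      Complex.I * α * (-Complex.I * t) - β * (-Complex.I * t) ^ (2 * μ) := by
    let D : Polynomial ℂ := (∑ ν ∈ Finset.range (2 * μ + 1),
      Polynomial.monomial ν (γ ν / (ν.factorial : ℂ))) -
      (Polynomial.monomial 1 (Complex.I * α * -Complex.I) -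
        Polynomial.monomial (2 * μ) (β * (-Complex.I) ^ (2 * μ)))
    have hDe : ∀ t, D.eval t = q (2 * μ + 1) t -
        (Complex.I * α * (-Complex.I * t) - β * (-Complex.I * t) ^ (2 * μ)) := fun t => by
      simp only [D, q, Polynomial.eval_sub, Polynomial.eval_finsetSum, Polynomial.eval_monomial,
        mul_pow]
      ring
    have hDO : (fun t => D.eval t) =O[𝓝 0] fun t : ℂ => t ^ (2 * μ + 1) := by
      refine (hRI.sub (hq (2 * μ + 1))).congr_left fun t => ?_
      rw [hDe]
      simp only [hR]
      ring
    have hDc := coeff_eq_zero_of_isBigO (hDO.mono nhdsWithin_le_nhds)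
    have hD0 : D = 0 := by
      ext i
      rw [Polynomial.coeff_zero]
      rcases lt_or_ge i (2 * μ + 1) with hi | hi
      · exact hDc i hi
      · simp only [D, Polynomial.coeff_sub, Polynomial.finsetSum_coeff, Polynomial.coeff_monomial]
        rw [if_neg (by omega), if_neg (by omega), Finset.sum_eq_zero]
        · simp
        · intro ν hν
          rw [if_neg]
          have := Finset.mem_range.mp hν
          omega
    intro t
    have := hDe t
    rw [hD0, Polynomial.eval_zero] at this
    exact (sub_eq_zero.mp this.symm)
  set g : ℂ → ℂ := fun t => R (-Complex.I * t) / t ^ (2 * μ) with hg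
  -- Division by zero gives the value `0`, which agrees with the vanishing constant term of
  -- `reducedSeries`.
  have hg0 : g 0 = 0 := by
    simp [hg, hμ.ne']
  have htr : ∀ M t, t ^ (2 * μ) * (PowerSeries.trunc (M + 1) (reducedSeries γ μ)).eval t =
      q (2 * μ + (M + 1)) t - q (2 * μ + 1) t := by
    intro M t
    simp only [q]
    rw [eval_trunc, ← add_assoc, add_right_comm (2 * μ) M 1, Finset.sum_range_add _ (2 * μ + 1),
      add_sub_cancel_left, Finset.sum_range_succ', mul_add, Finset.mul_sum]
    simp only [reducedSeries, PowerSeries.coeff_mk, if_true, zero_mul, mul_zero, add_zero]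
    refine Finset.sum_congr rfl fun ν _ => ?_
    rw [if_neg (Nat.succ_ne_zero ν), add_assoc (2 * μ) 1 ν, add_comm 1 ν, pow_add t (2 * μ)]
    ring
  have hexpand : ∀ M, (fun t => g t - (PowerSeries.trunc (M + 1) (reducedSeries γ μ)).eval t)
      =O[𝓝 0] fun t : ℂ => t ^ (M + 1) := by
    intro M
    obtain ⟨C, hC⟩ := (hq (2 * μ + (M + 1))).bound
    refine IsBigO.of_bound C ?_
    filter_upwards [hC] with t ht
    rcases eq_or_ne t 0 with rfl | ht0
    · rw [hg0, eval_trunc, Finset.sum_range_succ']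
      simp [reducedSeries]
    · have e : G (-Complex.I * t) - q (2 * μ + (M + 1)) t =
          t ^ (2 * μ) * (g t - (PowerSeries.trunc (M + 1) (reducedSeries γ μ)).eval t) := by
        have h1 : t ^ (2 * μ) * g t = R (-Complex.I * t) := by
          simp only [hg]
          field_simp
        rw [mul_sub, htr, h1, hlow]
        simp only [hR]
        ring
      rw [e, norm_mul, pow_add, norm_mul] at ht
      have hpos : 0 < ‖t ^ (2 * μ)‖ := norm_pos_iff.mpr (pow_ne_zero _ ht0)
      refine le_of_mul_le_mul_left ?_ hpos
      linarith
  refine ⟨R, g, hRan, ?_, Eventually.of_forall fun ξ => ?_, ?_⟩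
  · intro M
    rcases M with _ | M
    · have h1 : (fun t : ℂ => t ^ (0 + 1)) =O[𝓝 0] fun t : ℂ => t ^ 0 := by
        simpa using (continuous_id.tendsto (0 : ℂ)).isBigO_one ℂ
      refine ((hexpand 0).trans h1).congr_left fun t => ?_
      simp [reducedSeries]
    · exact hexpand M
  · rcases eq_or_ne ξ 0 with rfl | hξ
    · simp [hR, hGdef, hf0, hμ.ne']
    · have : (Complex.I * ξ) ^ (2 * μ) ≠ 0 := pow_ne_zero _ (mul_ne_zero Complex.I_ne_zero hξ)
      simp only [hg]
      rw [mul_div_cancel₀ _ this, ← mul_assoc]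
      simp
  · filter_upwards [hf.continuousAt.eventually_ne (by rw [hf0]; exact one_ne_zero)] with ξ hξ
    simp only [hR, hGdef]
    have : Complex.I * α * ξ - β * ξ ^ (2 * μ) +
      (Complex.log (f ξ) - Complex.I * α * ξ + β * ξ ^ (2 * μ)) = Complex.log (f ξ) := by ring
    rw [this, Complex.exp_log hξ]

/-! ### The attractor and its derivatives as Fourier integrals. -/

theorem norm_one_div_two_pi_le : ‖(1 / (2 * (Real.pi : ℂ)))‖ ≤ 1 := by
  rw [norm_div, norm_one, norm_mul, Complex.norm_real, Real.norm_of_nonneg Real.pi_pos.le,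
    Complex.norm_ofNat, div_le_one (by positivity)]
  linarith [Real.pi_gt_three]

open MeasureTheory in
theorem integrable_exp_neg_mul_pow {c : ℝ} (hc : 0 < c) {μ : ℕ} (hμ : 0 < μ) :
    Integrable fun θ : ℝ => Real.exp (-(c * θ ^ (2 * μ))) := by
  refine ((integrable_exp_neg_mul_sq hc).const_mul (Real.exp c)).mono'
    (Continuous.aestronglyMeasurable (by fun_prop)) (Eventually.of_forall fun θ => ?_)
  rw [Real.norm_of_nonneg (Real.exp_pos _).le, ← Real.exp_add]
  refine Real.exp_le_exp.mpr ?_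
  have h : θ ^ 2 ≤ 1 + θ ^ (2 * μ) := by
    rw [pow_mul]
    rcases le_total (θ ^ 2) 1 with h1 | h1
    · linarith [pow_nonneg (sq_nonneg θ) μ]
    · linarith [le_self_pow₀ h1 hμ.ne']
  nlinarith

theorem exists_norm_eval_le_exp (P : Polynomial ℂ) {μ : ℕ} (hμ : 0 < μ) {ε : ℝ} (hε : 0 < ε) :
    ∃ C : ℝ, 0 < C ∧ ∀ u : ℝ, ‖P.eval (Complex.I * u)‖ ≤ C * Real.exp (ε * u ^ (2 * μ)) := by
  choose B hB hBb using fun k : ℕ => exists_pow_le_exp_pow k (show 2 * μ ≠ 0 by omega) hε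
  refine ⟨1 + ∑ j ∈ P.support, ‖P.coeff j‖ * B j, ?_, fun u => ?_⟩
  · have : 0 ≤ ∑ j ∈ P.support, ‖P.coeff j‖ * B j :=
      Finset.sum_nonneg fun j _ => mul_nonneg (norm_nonneg _) (hB j).le
    linarith
  rw [Polynomial.eval_eq_sum, Polynomial.sum]
  have hle : ‖∑ j ∈ P.support, P.coeff j * (Complex.I * u) ^ j‖ ≤
      ∑ j ∈ P.support, ‖P.coeff j‖ * B j * Real.exp (ε * u ^ (2 * μ)) := by
    refine norm_sum_le_of_le _ fun j _ => ?_
    have h1 := hBb j |u| (abs_nonneg u)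
    rw [Even.pow_abs (even_two_mul μ)] at h1
    rw [norm_mul, norm_pow, norm_mul, Complex.norm_I, one_mul, Complex.norm_real, Real.norm_eq_abs,
      mul_assoc]
    exact mul_le_mul_of_nonneg_left h1 (norm_nonneg _)
  rw [← Finset.sum_mul] at hle
  refine hle.trans ?_
  rw [add_mul]
  linarith [Real.exp_pos (ε * u ^ (2 * μ))]

/-- The integrand of the attractor. -/
noncomputable def kernel (μ : ℕ) (β : ℂ) (x θ : ℝ) : ℂ :=
  Complex.exp (-(Complex.I * (x : ℂ) * (θ : ℂ))) * Complex.exp (-(β * (θ : ℂ) ^ (2 * μ)))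

theorem norm_kernel (μ : ℕ) (β : ℂ) (x θ : ℝ) :
    ‖kernel μ β x θ‖ = Real.exp (-(β.re * θ ^ (2 * μ))) := by
  have h : (β * (θ : ℂ) ^ (2 * μ)).re = β.re * θ ^ (2 * μ) := by
    rw [← Complex.ofReal_pow, Complex.re_mul_ofReal]
  rw [kernel, norm_mul, Complex.norm_exp, Complex.norm_exp, Complex.neg_re, Complex.neg_re, h]
  simp

theorem continuous_kernel (μ : ℕ) (β : ℂ) (x : ℝ) : Continuous (kernel μ β x) := by
  unfold kernel
  fun_prop

theorem exists_norm_eval_mul_kernel_le (P : Polynomial ℂ) {μ : ℕ} (hμ : 0 < μ) {β : ℂ}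
    (hβ : 0 < β.re) : ∃ C : ℝ, 0 < C ∧ ∀ x θ : ℝ, ‖P.eval (Complex.I * θ) * kernel μ β x θ‖ ≤
      C * Real.exp (-(β.re / 2 * θ ^ (2 * μ))) := by
  obtain ⟨C, hC, h⟩ := exists_norm_eval_le_exp P hμ (half_pos hβ)
  refine ⟨C, hC, fun x θ => ?_⟩
  rw [norm_mul, norm_kernel]
  refine (mul_le_mul_of_nonneg_right (h θ) (Real.exp_pos _).le).trans (le_of_eq ?_)
  rw [mul_assoc, ← Real.exp_add]
  ring_nf

open MeasureTheory in
theorem integrable_eval_mul_kernel (P : Polynomial ℂ) {μ : ℕ} (hμ : 0 < μ) {β : ℂ}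
    (hβ : 0 < β.re) (x : ℝ) : Integrable fun θ : ℝ => P.eval (Complex.I * θ) * kernel μ β x θ := by
  obtain ⟨C, -, h⟩ := exists_norm_eval_mul_kernel_le P hμ hβ
  refine ((integrable_exp_neg_mul_pow (half_pos hβ) hμ).const_mul C).mono'
    (Continuous.aestronglyMeasurable ?_) (Eventually.of_forall fun θ => h x θ)
  exact (P.continuous.comp (by fun_prop)).mul (continuous_kernel μ β x)

open MeasureTheory FourierTransform in
-- The attractor is `1 / (2 π)` times the Fourier transform of `f` at `x / (2 π)`. All moments of
-- `f` are integrable, so the transform may be differentiated under the integral, and the chain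
-- rule's `(2 π) ^ (-j)` cancels the factors `2 π`.
theorem iteratedDeriv_attractor {μ : ℕ} (hμ : 0 < μ) {β : ℂ} (hβ : 0 < β.re) (j : ℕ) (x : ℝ) :
    iteratedDeriv j (attractor μ β) x =
      (1 / (2 * (Real.pi : ℂ))) * ∫ θ : ℝ, (-(Complex.I * θ)) ^ j * kernel μ β x θ := by
  set f : ℝ → ℂ := fun θ => Complex.exp (-(β * (θ : ℂ) ^ (2 * μ))) with hf
  have hint : ∀ n : ℕ, Integrable fun θ : ℝ => (θ : ℂ) ^ n * f θ := fun n => by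
    have := (integrable_eval_mul_kernel (Polynomial.monomial n ((-Complex.I) ^ n)) hμ hβ 0)
    refine this.congr (Eventually.of_forall fun θ => ?_)
    simp only [kernel, Polynomial.eval_monomial, hf]
    rw [← mul_pow]
    simp [← mul_assoc]
  have hker : ∀ x θ : ℝ, kernel μ β x θ =
      Complex.exp (((-2 * Real.pi * θ * ((2 * Real.pi)⁻¹ * x) : ℝ) : ℂ) * Complex.I) * f θ := by
    intro x θ
    rw [kernel, hf]
    congr 2
    have : (Real.pi : ℂ) ≠ 0 := by exact_mod_cast Real.pi_ne_zero
    push_cast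
    field_simp
  have hH : attractor μ β = fun x => (1 / (2 * (Real.pi : ℂ))) * 𝓕 f ((2 * Real.pi)⁻¹ * x) := by
    funext x
    rw [attractor, Real.fourier_real_eq_integral_exp_smul]
    congr 1
    refine integral_congr_ae (Eventually.of_forall fun θ => ?_)
    exact hker x θ
  have hcd : ContDiff ℝ ((⊤ : ℕ∞) : WithTop ℕ∞) (𝓕 f) := Real.contDiff_fourier fun n _ => by
    refine (hint n).norm.congr (Eventually.of_forall fun θ => ?_)
    simp
  have hcdj : ContDiff ℝ (j : WithTop ℕ∞) (𝓕 f) := hcd.of_le (by exact_mod_cast le_top)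
  rw [hH, iteratedDeriv_const_mul_field, iteratedDeriv_comp_const_smul hcdj,
    Real.iteratedDeriv_fourier (N := ⊤) (fun n _ => (hint n).congr
      (Eventually.of_forall fun θ => by simp)) le_top]
  beta_reduce
  rw [Real.fourier_real_eq_integral_exp_smul, ← integral_smul]
  congr 1
  refine integral_congr_ae (Eventually.of_forall fun θ => ?_)
  simp only [hker, Complex.real_smul, smul_eq_mul]
  have : (Real.pi : ℂ) ≠ 0 := by exact_mod_cast Real.pi_ne_zero
  have e : (-(Complex.I * (θ : ℂ))) ^ j =
      (((2 * Real.pi)⁻¹ ^ j : ℝ) : ℂ) * (-2 * Real.pi * Complex.I * θ) ^ j := by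
    push_cast
    rw [← mul_pow]
    congr 1
    field_simp
  rw [e]
  ring

open MeasureTheory in
-- `-d/dx` acts on `exp (-I x θ)` as multiplication by `I θ`.
theorem applyNegDeriv_attractor (P : Polynomial ℂ) {μ : ℕ} (hμ : 0 < μ) {β : ℂ} (hβ : 0 < β.re)
    (x : ℝ) : applyNegDeriv P (attractor μ β) x =
      (1 / (2 * (Real.pi : ℂ))) * ∫ θ : ℝ, P.eval (Complex.I * θ) * kernel μ β x θ := by
  have h : ∀ θ : ℝ, P.eval (Complex.I * θ) * kernel μ β x θ =
      ∑ j ∈ P.support, P.coeff j * ((-1) ^ j * ((-(Complex.I * θ)) ^ j * kernel μ β x θ)) := by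
    intro θ
    rw [Polynomial.eval_eq_sum, Polynomial.sum, Finset.sum_mul]
    refine Finset.sum_congr rfl fun j _ => ?_
    rw [← mul_assoc ((-1) ^ j), ← mul_pow]
    simp [mul_assoc]
  have hint : ∀ j : ℕ, Integrable fun θ : ℝ => (-(Complex.I * θ)) ^ j * kernel μ β x θ :=
    fun j => by
      refine (integrable_eval_mul_kernel (Polynomial.monomial j ((-1) ^ j)) hμ hβ x).congr
        (Eventually.of_forall fun θ => ?_)
      simp only [Polynomial.eval_monomial]
      rw [← mul_pow, neg_one_mul]
  simp_rw [h]
  rw [integral_finsetSum _ fun j _ => ((hint j).const_mul _).const_mul _, Finset.mul_sum,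
    applyNegDeriv, Polynomial.sum]
  refine Finset.sum_congr rfl fun j _ => ?_
  rw [iteratedDeriv_attractor hμ hβ, integral_const_mul, integral_const_mul]
  ring

open MeasureTheory in
/-- The correction terms are integrals over a short interval, up to exponentially small errors. -/
theorem exists_norm_applyNegDeriv_sub_le (P : Polynomial ℂ) {μ : ℕ} (hμ : 0 < μ) {β : ℂ}
    (hβ : 0 < β.re) {δ : ℝ} (hδ : 0 < δ) : ∃ C : ℝ, 0 < C ∧ ∃ c : ℝ, 0 < c ∧
      ∀ N : ℝ, 1 ≤ N → ∀ x : ℝ,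
      ‖(N : ℂ)⁻¹ * applyNegDeriv P (attractor μ β) x - (1 / (2 * (Real.pi : ℂ))) *
        ∫ θ in (-δ)..δ, P.eval (N * (Complex.I * θ)) * kernel μ β x (N * θ)‖ ≤
        C * Real.exp (-(c * N ^ (2 * μ))) := by
  obtain ⟨C, hC, hCb⟩ := exists_norm_eval_mul_kernel_le P hμ hβ
  -- Once `P` is absorbed the decay rate is `β.re / 2 = 2 * b`: one `b` gives the small factor from
  -- `|θ| ≥ δ`, the other keeps the tail integrable.
  set b := β.re / 4 with hb
  have hb0 : 0 < b := by positivity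
  set J := ∫ θ : ℝ, Real.exp (-(b * θ ^ (2 * μ))) with hJ
  have hJ0 : 0 ≤ J := integral_nonneg fun θ => (Real.exp_pos _).le
  have hJ1 : 0 < J + 1 := by linarith
  refine ⟨C * (J + 1), mul_pos hC hJ1, b * δ ^ (2 * μ), by positivity, fun N hN x => ?_⟩
  have hN0 : 0 < N := by linarith
  set Ψ : ℝ → ℂ := fun θ => P.eval (N * (Complex.I * θ)) * kernel μ β x (N * θ) with hΨ
  have hΨe : ∀ θ : ℝ, Ψ θ = (fun u : ℝ => P.eval (Complex.I * u) * kernel μ β x u) (N * θ) := by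
    intro θ
    simp only [hΨ]
    congr 2
    push_cast
    ring
  have hΨi : Integrable Ψ := by
    have := (integrable_comp_mul_left_iff _ hN0.ne').mpr (integrable_eval_mul_kernel P hμ hβ x)
    exact this.congr (Eventually.of_forall fun θ => (hΨe θ).symm)
  have hfull : (N : ℂ)⁻¹ * applyNegDeriv P (attractor μ β) x =
      (1 / (2 * (Real.pi : ℂ))) * ∫ θ : ℝ, Ψ θ := by
    rw [integral_congr_ae (Eventually.of_forall hΨe), Measure.integral_comp_mul_left
      (fun u : ℝ => P.eval (Complex.I * u) * kernel μ β x u), applyNegDeriv_attractor P hμ hβ,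
      abs_of_pos (inv_pos.mpr hN0), Complex.real_smul]
    push_cast
    ring
  rw [hfull, ← mul_sub, intervalIntegral.integral_of_le (by linarith)]
  have hcompl := integral_add_compl (measurableSet_Ioc (a := -δ) (b := δ)) hΨi
  rw [← hcompl, add_sub_cancel_left, norm_mul]
  have hpi := norm_one_div_two_pi_le
  have hbound : ∀ θ ∈ (Set.Ioc (-δ) δ)ᶜ, ‖Ψ θ‖ ≤
      C * Real.exp (-(b * δ ^ (2 * μ) * N ^ (2 * μ))) * Real.exp (-(b * θ ^ (2 * μ))) := by
    intro θ hθ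
    have hθ' : δ ≤ |θ| := by
      by_contra hlt
      push Not at hlt
      exact hθ ⟨(abs_lt.mp hlt).1, (abs_lt.mp hlt).2.le⟩
    rw [hΨe]
    refine (hCb x (N * θ)).trans ?_
    rw [mul_assoc, ← Real.exp_add]
    refine mul_le_mul_of_nonneg_left (Real.exp_le_exp.mpr ?_) hC.le
    have h1 : δ ^ (2 * μ) ≤ θ ^ (2 * μ) := by
      rw [← Even.pow_abs (even_two_mul μ) θ]
      exact pow_le_pow_left₀ hδ.le hθ' _
    have h2 : 1 ≤ N ^ (2 * μ) := one_le_pow₀ hN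
    have h3 : 0 ≤ θ ^ (2 * μ) := (by positivity : 0 ≤ δ ^ (2 * μ)).trans h1
    rw [mul_pow, show β.re / 2 = 2 * b by rw [hb]; ring]
    have h4 := mul_le_mul_of_nonneg_left h1 (by linarith : 0 ≤ N ^ (2 * μ))
    have h5 := mul_le_mul_of_nonneg_right h2 h3
    nlinarith
  have hnorm : ‖∫ θ in (Set.Ioc (-δ) δ)ᶜ, Ψ θ‖ ≤
      C * Real.exp (-(b * δ ^ (2 * μ) * N ^ (2 * μ))) * J := by
    have hi := (integrable_exp_neg_mul_pow hb0 hμ).const_mul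
      (C * Real.exp (-(b * δ ^ (2 * μ) * N ^ (2 * μ))))
    refine (norm_integral_le_of_norm_le hi.integrableOn
      ((ae_restrict_iff' measurableSet_Ioc.compl).mpr (Eventually.of_forall hbound))).trans ?_
    rw [hJ, ← integral_const_mul]
    exact setIntegral_le_integral hi (Eventually.of_forall fun θ => by
      simp only [Pi.zero_apply]; positivity)
  calc _ ≤ 1 * (C * Real.exp (-(b * δ ^ (2 * μ) * N ^ (2 * μ))) * J) := by gcongr
    _ ≤ C * (J + 1) * Real.exp (-(b * δ ^ (2 * μ) * N ^ (2 * μ))) := by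
      nlinarith [mul_pos hC (Real.exp_pos (-(b * δ ^ (2 * μ) * N ^ (2 * μ))))]

/-! ### Contour shift and generalized Gaussian bounds. -/

/-- Shifting the segment of integration vertically. -/
theorem norm_integral_le_shift {Φ : ℂ → ℂ} {δ η S : ℝ}
    (hΦ : DifferentiableOn ℂ Φ (Set.uIcc (-δ) δ ×ℂ Set.uIcc 0 η))
    (hr : ∀ t ∈ Set.uIcc 0 η, ‖Φ ((δ : ℂ) + t * Complex.I)‖ ≤ S)
    (hl : ∀ t ∈ Set.uIcc 0 η, ‖Φ (((-δ : ℝ) : ℂ) + t * Complex.I)‖ ≤ S) :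
    ‖∫ θ in (-δ)..δ, Φ (θ : ℝ)‖ ≤
      ‖∫ θ in (-δ)..δ, Φ ((θ : ℝ) + η * Complex.I)‖ + 2 * |η| * S := by
  have h := Complex.integral_boundary_rect_eq_zero_of_differentiableOn Φ (((-δ : ℝ) : ℂ))
    ((δ : ℂ) + η * Complex.I) (by simpa using hΦ)
  simp only [Complex.ofReal_re, Complex.ofReal_im, Complex.add_re, Complex.add_im,
    Complex.mul_re, Complex.mul_im, Complex.I_re, Complex.I_im, mul_zero, mul_one, sub_zero,
    add_zero, zero_add, Complex.ofReal_zero, zero_mul] at h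
  have e : ∫ θ in (-δ)..δ, Φ (θ : ℝ) = (∫ θ in (-δ)..δ, Φ ((θ : ℝ) + η * Complex.I)) +
      (Complex.I • (∫ t in (0 : ℝ)..η, Φ (((-δ : ℝ) : ℂ) + t * Complex.I)) -
        Complex.I • ∫ t in (0 : ℝ)..η, Φ ((δ : ℂ) + t * Complex.I)) := by
    linear_combination h
  have hr' := intervalIntegral.norm_integral_le_of_norm_le_const
    (f := fun t : ℝ => Φ ((δ : ℂ) + t * Complex.I)) (a := 0) (b := η)
    fun t ht => hr t (Set.uIoc_subset_uIcc ht)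
  have hl' := intervalIntegral.norm_integral_le_of_norm_le_const
    (f := fun t : ℝ => Φ (((-δ : ℝ) : ℂ) + t * Complex.I)) (a := 0) (b := η)
    fun t ht => hl t (Set.uIoc_subset_uIcc ht)
  rw [sub_zero] at hr' hl'
  rw [e]
  refine (norm_add_le _ _).trans (add_le_add_right ((norm_sub_le _ _).trans ?_) _)
  rw [norm_smul, norm_smul, Complex.norm_I]
  linarith

/-- In a thin cone around the real axis, `Re (β ξ ^ (2 μ))` controls `(Re ξ) ^ (2 μ)`. -/
theorem exists_neg_re_mul_pow_le {β : ℂ} (hβ : 0 < β.re) (μ : ℕ) :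
    ∃ ε : ℝ, 0 < ε ∧ ∃ c : ℝ, 0 < c ∧ ∃ C : ℝ, 0 < C ∧ ∀ ξ : ℂ,
      -(β * ξ ^ (2 * μ)).re + ε * ‖ξ‖ ^ (2 * μ) ≤ -(c * ξ.re ^ (2 * μ)) + C * ξ.im ^ (2 * μ) := by
  set ε := β.re / 8 with hε
  -- By homogeneity the cone around the real axis reduces to the points `1 + u * I` with `u` small.
  have hcont : Tendsto (fun u : ℝ => -(β * (1 + u * Complex.I) ^ (2 * μ)).re +
      ε * ‖(1 + u * Complex.I)‖ ^ (2 * μ)) (𝓝 0) (𝓝 (-β.re + ε)) := by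
    have h : Continuous (fun u : ℝ => -(β * (1 + u * Complex.I) ^ (2 * μ)).re +
      ε * ‖(1 + u * Complex.I)‖ ^ (2 * μ)) := by fun_prop
    simpa using h.tendsto 0
  obtain ⟨r, hr, hball⟩ := Metric.eventually_nhds_iff.mp
    (hcont.eventually_le_const (show -β.re + ε < -(β.re / 2) by rw [hε]; linarith))
  set ρ := r / 2 with hρ
  have hρ0 : 0 < ρ := half_pos hr
  set C := (‖β‖ + ε) * (1 + ρ⁻¹) ^ (2 * μ) + β.re / 2 * ρ⁻¹ ^ (2 * μ) with hC
  have hC0 : 0 < C := by positivity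
  refine ⟨ε, by positivity, β.re / 2, by positivity, C, hC0, fun ξ => ?_⟩
  have heven : Even (2 * μ) := even_two_mul μ
  -- Outside the cone `|ξ.re| ≤ ρ⁻¹ * |ξ.im|`, and every term is dominated by `ξ.im ^ (2 * μ)`.
  rcases le_or_gt |ξ.im| (ρ * |ξ.re|) with h | h
  · rcases eq_or_ne ξ.re 0 with h0 | h0
    · have him : ξ.im = 0 := by simpa [h0] using h
      have hξ : ξ = 0 := Complex.ext h0 him
      rcases Nat.eq_zero_or_pos μ with hμ | hμ
      · subst hμ
        simp only [mul_zero, pow_zero, mul_one]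
        have h1 : (1 : ℝ) ≤ (1 + ρ⁻¹) ^ (2 * 0) := by simp
        simp only [mul_zero, pow_zero, mul_one] at hC
        rw [hC]
        linarith [norm_nonneg β]
      · simp [hξ, hμ.ne']
    · set u := ξ.im / ξ.re with hu
      have hu1 : |u| < r := by
        rw [hu, abs_div, div_lt_iff₀ (abs_pos.mpr h0)]
        have : ρ * |ξ.re| < r * |ξ.re| := by
          have := abs_pos.mpr h0
          rw [hρ]; nlinarith
        linarith
      have hb := hball (y := u) (by simpa using hu1)
      have hξ : ξ = (ξ.re : ℂ) * (1 + u * Complex.I) := by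
        apply Complex.ext <;> simp [hu]
        field_simp
      have h1 : (β * ξ ^ (2 * μ)).re =
          ξ.re ^ (2 * μ) * (β * (1 + u * Complex.I) ^ (2 * μ)).re := by
        conv_lhs => rw [hξ]
        rw [mul_pow, ← Complex.ofReal_pow, mul_left_comm, Complex.re_ofReal_mul]
      have h2 : ‖ξ‖ ^ (2 * μ) = ξ.re ^ (2 * μ) * ‖1 + u * Complex.I‖ ^ (2 * μ) := by
        conv_lhs => rw [hξ]
        rw [norm_mul, mul_pow, Complex.norm_real, Real.norm_eq_abs, heven.pow_abs]
      rw [h1, h2]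
      have h3 : 0 ≤ ξ.re ^ (2 * μ) := heven.pow_nonneg _
      have h4 : 0 ≤ C * ξ.im ^ (2 * μ) := mul_nonneg hC0.le (heven.pow_nonneg _)
      nlinarith [mul_le_mul_of_nonneg_left hb h3]
  · have hre : |ξ.re| ≤ ρ⁻¹ * |ξ.im| := by
      rw [inv_mul_eq_div, le_div_iff₀ hρ0]
      linarith
    have hn : ‖ξ‖ ≤ (1 + ρ⁻¹) * |ξ.im| := by
      refine (Complex.norm_le_abs_re_add_abs_im ξ).trans ?_
      linarith
    have h1 : ‖ξ‖ ^ (2 * μ) ≤ (1 + ρ⁻¹) ^ (2 * μ) * ξ.im ^ (2 * μ) := by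
      rw [← heven.pow_abs ξ.im, ← mul_pow]
      exact pow_le_pow_left₀ (norm_nonneg _) hn _
    have h2 : ξ.re ^ (2 * μ) ≤ ρ⁻¹ ^ (2 * μ) * ξ.im ^ (2 * μ) := by
      rw [← heven.pow_abs ξ.im, ← heven.pow_abs ξ.re, ← mul_pow]
      exact pow_le_pow_left₀ (abs_nonneg _) hre _
    have h3 : -(β * ξ ^ (2 * μ)).re ≤ ‖β‖ * ‖ξ‖ ^ (2 * μ) := by
      rw [← norm_pow, ← norm_mul]
      exact (neg_le_abs _).trans (Complex.abs_re_le_norm _)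
    have h4 := mul_le_mul_of_nonneg_left h1 (by positivity : 0 ≤ ‖β‖ + ε)
    have h5 := mul_le_mul_of_nonneg_left h2 (by positivity : 0 ≤ β.re / 2)
    rw [hC]
    nlinarith

/-- Exponentially small errors are absorbed in the generalized Gaussian bound. -/
theorem exists_exp_le_absorb {c B : ℝ} (hc : 0 < c) (hB : 0 < B) {μ : ℕ} (hμ : 0 < μ) (k : ℕ) :
    ∃ C : ℝ, 0 < C ∧ ∃ c' : ℝ, 0 < c' ∧ ∀ N y : ℝ, 0 < N → 0 ≤ y → y ≤ B * N →
      Real.exp (-(c * N ^ (2 * μ))) ≤ C * (N ^ k)⁻¹ * Real.exp (-(c' * y ^ (2 * μ))) := by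
  obtain ⟨C, hC, h⟩ := exists_pow_le_exp_pow k (show 2 * μ ≠ 0 by omega) (half_pos hc)
  -- Half of the rate `c` pays for `N ^ k`; the other half becomes decay in `y` through `y ≤ B * N`.
  refine ⟨C, hC, c / 2 / B ^ (2 * μ), by positivity, fun N y hN hy hyB => ?_⟩
  have h1 := h N hN.le
  have h2 : c / 2 / B ^ (2 * μ) * y ^ (2 * μ) ≤ c / 2 * N ^ (2 * μ) := by
    have h3 := pow_le_pow_left₀ hy hyB (2 * μ)
    rw [mul_pow] at h3
    rw [div_mul_eq_mul_div, div_le_iff₀ (by positivity)]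
    nlinarith
  have h4 : 1 ≤ C * (N ^ k)⁻¹ * Real.exp (c / 2 * N ^ (2 * μ)) := by
    rw [mul_right_comm, ← div_eq_mul_inv, le_div_iff₀ (by positivity)]
    linarith
  calc Real.exp (-(c * N ^ (2 * μ))) ≤
      C * (N ^ k)⁻¹ * Real.exp (c / 2 * N ^ (2 * μ)) * Real.exp (-(c * N ^ (2 * μ))) :=
        le_mul_of_one_le_left (Real.exp_pos _).le h4
    _ = C * (N ^ k)⁻¹ * Real.exp (-(c / 2 * N ^ (2 * μ))) := by
        rw [mul_assoc, ← Real.exp_add]; ring_nf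
    _ ≤ _ := by
        refine mul_le_mul_of_nonneg_left (Real.exp_le_exp.mpr (by linarith)) (by positivity)

open MeasureTheory in
/-- A contour shift at the optimal height turns a pointwise bound in the complex domain into a
generalized Gaussian bound. -/
theorem exists_norm_integral_le_gaussian {μ : ℕ} (hμ : 0 < μ) {c₁ C₁ δ η₀ B : ℝ} (hc₁ : 0 < c₁)
    (hC₁ : 0 < C₁) (hδ : 0 < δ) (hη₀ : 0 < η₀) (hB : 0 < B) :
    ∃ C : ℝ, 0 < C ∧ ∃ c : ℝ, 0 < c ∧ ∀ (N : ℝ) (x y D : ℝ) (Φ : ℂ → ℂ), 0 < N → 0 ≤ y →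
      |x| = y ^ (2 * μ - 1) → y ≤ B * N → 0 ≤ D →
      (∀ ξ : ℂ, |ξ.re| ≤ δ → |ξ.im| ≤ η₀ → DifferentiableAt ℂ Φ ξ) →
      (∀ ξ : ℂ, |ξ.re| ≤ δ → |ξ.im| ≤ η₀ → ‖Φ ξ‖ ≤ D * Real.exp (x * N * ξ.im +
        C₁ * (N * ξ.im) ^ (2 * μ) - c₁ * (N * ξ.re) ^ (2 * μ))) →
      ‖∫ θ in (-δ)..δ, Φ (θ : ℝ)‖ ≤ C * D * N⁻¹ * Real.exp (-(c * y ^ (2 * μ))) := by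
  set S := c₁ * δ ^ (2 * μ) with hS
  have hS0 : 0 < S := by positivity
  obtain ⟨A, hA, c', hc', habs⟩ := exists_exp_le_absorb (half_pos hS0) hB hμ 1
  set J := ∫ θ : ℝ, Real.exp (-(c₁ * θ ^ (2 * μ))) with hJ
  have hJ0 : 0 ≤ J := integral_nonneg fun θ => (Real.exp_pos _).le
  -- The four bounds on `τ` serve in turn to get `τ ^ (2 * μ) ≤ τ ^ 2`, to keep the contour in the
  -- strip, to let the gain `τ * y ^ (2 * μ)` beat the loss `C₁ * (τ * y) ^ (2 * μ)`, and to keep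
  -- that loss below half the decay `S * N ^ (2 * μ)` on the vertical sides.
  set τ := min (min 1 (η₀ / B)) (min (1 / (2 * C₁)) (S / (2 * (C₁ * B ^ (2 * μ))))) with hτ
  have hτ0 : 0 < τ := by positivity
  have hτ1 : τ ≤ 1 := (min_le_left _ _).trans (min_le_left _ _)
  have hτ2 : τ * B ≤ η₀ := by
    rw [← le_div_iff₀ hB]
    exact (min_le_left _ _).trans (min_le_right _ _)
  have hτ3 : C₁ * τ ≤ 1 / 2 := by
    have : τ ≤ 1 / (2 * C₁) := (min_le_right _ _).trans (min_le_left _ _)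
    rw [le_div_iff₀ (by positivity)] at this
    linarith
  have hτ4 : C₁ * τ * B ^ (2 * μ) ≤ S / 2 := by
    have : τ ≤ S / (2 * (C₁ * B ^ (2 * μ))) := (min_le_right _ _).trans (min_le_right _ _)
    rw [le_div_iff₀ (by positivity)] at this
    linarith
  have heven : Even (2 * μ) := even_two_mul μ
  obtain ⟨m, hm⟩ : ∃ m, 2 * μ = m + 2 := ⟨2 * μ - 2, by omega⟩
  have hτp : τ ^ (2 * μ) ≤ τ ^ 2 := by
    rw [hm, pow_add]
    exact mul_le_of_le_one_left (by positivity) (pow_le_one₀ hτ0.le hτ1)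
  refine ⟨J + 2 * η₀ * A, by positivity, min (τ / 2) c', by positivity,
    fun N x y D Φ hN hy hxy hyB hD hdiff hb => ?_⟩
  have hY0 : 0 ≤ y ^ (2 * μ) := by positivity
  set c := min (τ / 2) c' with hc
  obtain ⟨s, hs, hxs⟩ : ∃ s : ℝ, |s| = 1 ∧ x * s = -|x| := by
    rcases le_total 0 x with h | h
    · exact ⟨-1, by simp, by rw [abs_of_nonneg h]; ring⟩
    · exact ⟨1, by simp, by rw [abs_of_nonpos h]; ring⟩
  -- The sign `s` makes the linear term negative. At this height both it and the `2 * μ`-th power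
  -- term are multiples of `y ^ (2 * μ)`, because `|x| * y = y ^ (2 * μ)`.
  set η := s * (τ * y / N) with hη
  have hηabs : |η| = τ * y / N := by
    rw [hη, abs_mul, hs, one_mul, abs_of_nonneg (by positivity)]
  have hηle : |η| ≤ η₀ := by
    rw [hηabs, div_le_iff₀ hN]
    nlinarith
  have hxη : x * N * η = -(τ * y ^ (2 * μ)) := by
    have : x * N * η = (x * s) * (τ * y) := by
      rw [hη]; field_simp
    rw [this, hxs, hxy, hm, show m + 2 - 1 = m + 1 by omega]
    ring
  have hNη : (N * η) ^ (2 * μ) = τ ^ (2 * μ) * y ^ (2 * μ) := by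
    rw [← heven.pow_abs, abs_mul, hηabs, abs_of_pos hN, mul_div_cancel₀ _ hN.ne', mul_pow]
  have hside : ∀ t ∈ Set.uIcc 0 η, ∀ d : ℝ, |d| = δ →
      ‖Φ ((d : ℂ) + t * Complex.I)‖ ≤ D * Real.exp (-(S / 2 * N ^ (2 * μ))) := by
    intro t ht d hd
    obtain ⟨v, hv0, hv1, rfl⟩ : ∃ v : ℝ, 0 ≤ v ∧ v ≤ 1 ∧ t = v * η := by
      rw [← segment_eq_uIcc, segment_eq_image] at ht
      obtain ⟨v, hv, rfl⟩ := ht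
      exact ⟨v, hv.1, hv.2, by simp⟩
    have hvη : |v * η| ≤ |η| := by
      rw [abs_mul, abs_of_nonneg hv0]
      exact mul_le_of_le_one_left (abs_nonneg _) hv1
    have h1 := hb ((d : ℂ) + ((v * η : ℝ) : ℂ) * Complex.I) (by simp [hd])
      (by simpa using hvη.trans hηle)
    refine h1.trans (mul_le_mul_of_nonneg_left (Real.exp_le_exp.mpr ?_) hD)
    simp only [Complex.add_re, Complex.add_im, Complex.mul_re, Complex.mul_im, Complex.ofReal_re,
      Complex.ofReal_im, Complex.I_re, Complex.I_im, mul_zero, mul_one, sub_zero, add_zero,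
      zero_add]
    have h2 : x * N * (v * η) ≤ 0 := by
      have : x * N * (v * η) = v * (x * N * η) := by ring
      rw [this, hxη]
      have : 0 ≤ v * (τ * y ^ (2 * μ)) := by positivity
      linarith
    have h3 : (N * (v * η)) ^ (2 * μ) ≤ τ ^ (2 * μ) * y ^ (2 * μ) := by
      rw [← hNη, ← heven.pow_abs, ← heven.pow_abs (N * η), abs_mul N, abs_mul N η]
      gcongr
    have h4 : (N * d) ^ (2 * μ) = δ ^ (2 * μ) * N ^ (2 * μ) := by
      rw [← heven.pow_abs, abs_mul, hd, abs_of_pos hN, mul_pow, mul_comm]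
    have h5 : y ^ (2 * μ) ≤ B ^ (2 * μ) * N ^ (2 * μ) := by
      rw [← mul_pow]; exact pow_le_pow_left₀ hy hyB _
    have h6 : C₁ * (τ ^ (2 * μ) * y ^ (2 * μ)) ≤ S / 2 * N ^ (2 * μ) := by
      calc C₁ * (τ ^ (2 * μ) * y ^ (2 * μ)) ≤ C₁ * (τ * (B ^ (2 * μ) * N ^ (2 * μ))) := by
            have : τ ^ (2 * μ) ≤ τ := hτp.trans (by nlinarith)
            gcongr
        _ = C₁ * τ * B ^ (2 * μ) * N ^ (2 * μ) := by ring
        _ ≤ _ := by gcongr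
    rw [h4]
    have h7 := mul_le_mul_of_nonneg_left h3 hC₁.le
    rw [hS] at h6 ⊢
    linarith
  have hsub : ∀ ξ ∈ Set.uIcc (-δ) δ ×ℂ Set.uIcc 0 η, |ξ.re| ≤ δ ∧ |ξ.im| ≤ η₀ := by
    intro ξ hξ
    rw [Complex.mem_reProdIm] at hξ
    constructor
    · have := hξ.1
      rw [Set.uIcc_of_le (by linarith)] at this
      exact abs_le.mpr this
    · have := Set.abs_sub_left_of_mem_uIcc hξ.2
      rw [sub_zero, sub_zero] at this
      exact this.trans hηle
  have hshift := norm_integral_le_shift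
    (fun ξ hξ => (hdiff ξ (hsub ξ hξ).1 (hsub ξ hξ).2).differentiableWithinAt)
    (fun t ht => hside t ht δ (abs_of_pos hδ))
    (fun t ht => hside t ht (-δ) (by rw [abs_neg, abs_of_pos hδ]))
  have htop : ‖∫ θ in (-δ)..δ, Φ ((θ : ℝ) + η * Complex.I)‖ ≤
      D * Real.exp (-(τ / 2 * y ^ (2 * μ))) * (N⁻¹ * J) := by
    have hi0 := integrable_exp_neg_mul_pow hc₁ hμ
    have hi : Integrable fun θ : ℝ => D * Real.exp (-(τ / 2 * y ^ (2 * μ))) *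
        Real.exp (-(c₁ * (N * θ) ^ (2 * μ))) :=
      ((integrable_comp_mul_left_iff _ hN.ne').mpr hi0).const_mul _
    have hJN : ∫ θ : ℝ, Real.exp (-(c₁ * (N * θ) ^ (2 * μ))) = N⁻¹ * J := by
      rw [Measure.integral_comp_mul_left (fun u : ℝ => Real.exp (-(c₁ * u ^ (2 * μ)))),
        abs_of_pos (inv_pos.mpr hN), smul_eq_mul]
    rw [intervalIntegral.integral_of_le (by linarith), ← hJN, ← integral_const_mul]
    refine (norm_integral_le_of_norm_le hi.integrableOn
      ((ae_restrict_iff' measurableSet_Ioc).mpr (Eventually.of_forall fun θ hθ => ?_))).trans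
      (setIntegral_le_integral hi (Eventually.of_forall fun θ => by
        simp only [Pi.zero_apply]; positivity))
    have h1 := hb ((θ : ℂ) + η * Complex.I) (by
      simpa using abs_le.mpr ⟨hθ.1.le, hθ.2⟩) (by simpa using hηle)
    refine h1.trans ?_
    rw [mul_assoc D, ← Real.exp_add]
    refine mul_le_mul_of_nonneg_left (Real.exp_le_exp.mpr ?_) hD
    simp only [Complex.add_re, Complex.add_im, Complex.mul_re, Complex.mul_im, Complex.ofReal_re,
      Complex.ofReal_im, Complex.I_re, Complex.I_im, mul_zero, mul_one, sub_zero, add_zero,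
      zero_add]
    rw [hxη, hNη]
    have h2 : C₁ * (τ ^ (2 * μ) * y ^ (2 * μ)) ≤ τ / 2 * y ^ (2 * μ) := by
      rw [← mul_assoc]
      refine mul_le_mul_of_nonneg_right ?_ hY0
      nlinarith [mul_le_mul_of_nonneg_left hτp hC₁.le]
    linarith
  have h9 := habs N y hN hy hyB
  rw [pow_one] at h9
  have e1 : Real.exp (-(τ / 2 * y ^ (2 * μ))) ≤ Real.exp (-(c * y ^ (2 * μ))) := by
    refine Real.exp_le_exp.mpr (neg_le_neg ?_)
    exact mul_le_mul_of_nonneg_right (min_le_left _ _) hY0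
  have e2 : Real.exp (-(c' * y ^ (2 * μ))) ≤ Real.exp (-(c * y ^ (2 * μ))) := by
    refine Real.exp_le_exp.mpr (neg_le_neg ?_)
    exact mul_le_mul_of_nonneg_right (min_le_right _ _) hY0
  calc _ ≤ _ := hshift
    _ ≤ D * Real.exp (-(c * y ^ (2 * μ))) * (N⁻¹ * J) +
        2 * η₀ * (D * (A * N⁻¹ * Real.exp (-(c * y ^ (2 * μ))))) := by
      refine add_le_add (htop.trans ?_) ?_
      · gcongr
      · have := h9.trans (mul_le_mul_of_nonneg_left e2 (by positivity : 0 ≤ A * N⁻¹))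
        gcongr
    _ = _ := by ring

/-! ### Contribution of one tangency point. -/

/-- The local contribution of a tangency point is given by the attractor and its corrections, up
to an error with a generalized Gaussian bound. -/
theorem exists_norm_local_sub_le {μ : ℕ} (hμ : 0 < μ) {f : ℂ → ℂ} (hf : AnalyticAt ℂ f 0)
    (hf0 : f 0 = 1) {α : ℝ} {β : ℂ} (hβ : 0 < β.re)
    (hexp : ∃ R : ℂ → ℂ, (R =O[𝓝 0] fun ξ : ℂ => ξ ^ (2 * μ + 1)) ∧ ∀ᶠ ξ : ℂ in 𝓝 0,
      f ξ = Complex.exp (Complex.I * α * ξ - β * ξ ^ (2 * μ) + R ξ))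
    {γ : ℕ → ℂ} (hγ : ∀ ν, γ ν = iteratedDeriv ν (fun ξ => Complex.log (f ξ)) 0 / Complex.I ^ ν)
    (M : ℕ) :
    ∃ δ₀ : ℝ, 0 < δ₀ ∧ ∀ δ : ℝ, 0 < δ → δ ≤ δ₀ → ∀ B : ℝ, 0 < B →
      ∃ C : ℝ, 0 < C ∧ ∃ c : ℝ, 0 < c ∧ ∀ (n : ℕ) (l : ℤ) (N x y : ℝ), 1 ≤ N →
        N ^ (2 * μ) = n → x * N = l - α * n → 0 ≤ y → |x| = y ^ (2 * μ - 1) → y ≤ B * N →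
        ‖(1 / (2 * (Real.pi : ℂ))) * (∫ θ in (-δ)..δ,
            f (θ : ℝ) ^ n * Complex.exp (-(Complex.I * l * (θ : ℝ))))
          - ∑ m ∈ Finset.range (M + 1), ((N : ℂ) ^ (m + 1))⁻¹ *
            applyNegDeriv (correctionPoly γ μ m) (attractor μ β) x‖ ≤
          C * (N ^ (M + 2))⁻¹ * Real.exp (-(c * y ^ (2 * μ))) := by
  obtain rfl : γ = fun ν => iteratedDeriv ν (fun ξ => Complex.log (f ξ)) 0 / Complex.I ^ ν :=
    funext hγ
  clear hγ
  set γ : ℕ → ℂ := fun ν => iteratedDeriv ν (fun ξ => Complex.log (f ξ)) 0 / Complex.I ^ ν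
  obtain ⟨R, g, hRan, hg, hRg, hfR⟩ := exists_log_remainder hμ hf hf0 hexp
  obtain ⟨ε, hε, c₁, hc₁, C₁, hC₁, hcone⟩ := exists_neg_re_mul_pow_le hβ μ
  obtain ⟨δ₁, hδ₁, CE, hCE, hE⟩ := exists_norm_exp_sub_correction_le hμ hg hRg M hε
  obtain ⟨δ₂, hδ₂, hball⟩ := Metric.eventually_nhds_iff.mp
    (hRan.eventually_analyticAt.and hfR)
  -- The rectangle `|ξ.re|, |ξ.im| ≤ δ` lies in the disc of radius `2 * δ`, which has to fit inside
  -- both neighbourhoods, the second one open.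
  refine ⟨min (δ₁ / 2) (δ₂ / 3), by positivity, fun δ hδ hδle B hB => ?_⟩
  have hδ1 : 2 * δ ≤ δ₁ := by linarith [hδle.trans (min_le_left _ _)]
  have hδ2 : 2 * δ < δ₂ := by linarith [hδle.trans (min_le_right _ _)]
  obtain ⟨CI, hCI, cI, hcI, hI⟩ := exists_norm_integral_le_gaussian hμ hc₁ hC₁ hδ hδ hB
  choose CT hCT cT hcT hT using fun m : ℕ =>
    exists_norm_applyNegDeriv_sub_le (correctionPoly γ μ m) hμ hβ hδ
  choose CA hCA cA hcA hA using fun m : ℕ => exists_exp_le_absorb (hcT m) hB hμ (M + 2)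
  obtain ⟨c, hc, hcle⟩ : ∃ c : ℝ, 0 < c ∧ c ≤ cI ∧ ∀ m ∈ Finset.range (M + 1), c ≤ cA m := by
    have hne : (Finset.range (M + 1)).Nonempty := ⟨0, by simp⟩
    obtain ⟨m₀, -, hm₀⟩ := Finset.exists_min_image (Finset.range (M + 1)) cA hne
    exact ⟨min cI (cA m₀), lt_min hcI (hcA m₀), min_le_left _ _,
      fun m hm => (min_le_right _ _).trans (hm₀ m hm)⟩
  have hsum0 : 0 ≤ ∑ m ∈ Finset.range (M + 1), CT m * CA m :=
    Finset.sum_nonneg fun m _ => (mul_pos (hCT m) (hCA m)).le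
  refine ⟨CI * CE + ∑ m ∈ Finset.range (M + 1), CT m * CA m,
    by have := mul_pos hCI hCE; linarith, c, hc, fun n l N x y hN hNn hxN hy hxy hyB => ?_⟩
  have hN0 : 0 < N := by linarith
  have hNc : (N : ℂ) ≠ 0 := by exact_mod_cast hN0.ne'
  have hNnc : (N : ℂ) ^ (2 * μ) = n := by exact_mod_cast congrArg (fun r : ℝ => (r : ℂ)) hNn
  have hxNc : (x : ℂ) * N = l - α * n := by exact_mod_cast congrArg (fun r : ℝ => (r : ℂ)) hxN
  set T : ℂ → ℂ := fun ξ => ∑ m ∈ Finset.range (M + 1),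
    ((N : ℂ) ^ m)⁻¹ * (correctionPoly γ μ m).eval (N * (Complex.I * ξ)) with hTdef
  set Kr : ℂ → ℂ := fun ξ => Complex.exp (-(Complex.I * x * (N * ξ))) *
    Complex.exp (-(β * (N * ξ) ^ (2 * μ))) with hKr
  -- Only this difference is shifted off the real axis; the terms of `T` are integrated along it and
  -- completed to the whole line.
  set Φ : ℂ → ℂ := fun ξ => (Complex.exp ((N : ℂ) ^ (2 * μ) * R ξ) - T ξ) * Kr ξ with hΦ
  have hKrk : ∀ θ : ℝ, Kr θ = kernel μ β x (N * θ) := fun θ => by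
    simp only [hKr, kernel, Complex.ofReal_mul]
  have hTc : Continuous T := continuous_finsetSum _ fun m _ => continuous_const.mul
    ((correctionPoly γ μ m).continuous.comp (by fun_prop))
  have hTd : Differentiable ℂ T := by
    refine Differentiable.fun_sum fun m _ => ?_
    exact ((correctionPoly γ μ m).differentiable.comp (by fun_prop)).const_mul _
  have hsmall : ∀ ξ : ℂ, |ξ.re| ≤ δ → |ξ.im| ≤ δ → ‖ξ‖ ≤ 2 * δ := fun ξ h1 h2 =>
    (Complex.norm_le_abs_re_add_abs_im ξ).trans (by linarith)
  have hballξ : ∀ ξ : ℂ, ‖ξ‖ ≤ 2 * δ → AnalyticAt ℂ R ξ ∧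
      f ξ = Complex.exp (Complex.I * α * ξ - β * ξ ^ (2 * μ) + R ξ) := fun ξ hξ =>
    hball (y := ξ) (by rw [dist_zero_right]; linarith)
  have hΦd : ∀ ξ : ℂ, |ξ.re| ≤ δ → |ξ.im| ≤ δ → DifferentiableAt ℂ Φ ξ := fun ξ h1 h2 => by
    have hRd := (hballξ ξ (hsmall ξ h1 h2)).1.differentiableAt
    refine DifferentiableAt.mul (((hRd.const_mul _).cexp).sub (hTd ξ)) ?_
    simp only [hKr]
    fun_prop
  have hΦb : ∀ ξ : ℂ, |ξ.re| ≤ δ → |ξ.im| ≤ δ → ‖Φ ξ‖ ≤ CE * (N ^ (M + 1))⁻¹ *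
      Real.exp (x * N * ξ.im + C₁ * (N * ξ.im) ^ (2 * μ) - c₁ * (N * ξ.re) ^ (2 * μ)) := by
    intro ξ h1 h2
    have h3 := hE N hN0 ξ ((hsmall ξ h1 h2).trans hδ1)
    have h4 : ‖Kr ξ‖ = Real.exp (x * N * ξ.im) * Real.exp (-(β * (N * ξ) ^ (2 * μ)).re) := by
      simp only [hKr]
      rw [norm_mul, Complex.norm_exp, Complex.norm_exp]
      congr 2
      simp
      ring
    have h5 := hcone (N * ξ)
    rw [norm_mul, Complex.norm_of_nonneg hN0.le, Complex.re_ofReal_mul, Complex.im_ofReal_mul] at h5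
    simp only [hΦ]
    rw [norm_mul, h4]
    calc _ ≤ CE * (N ^ (M + 1))⁻¹ * Real.exp (ε * (N * ‖ξ‖) ^ (2 * μ)) *
          (Real.exp (x * N * ξ.im) * Real.exp (-(β * (N * ξ) ^ (2 * μ)).re)) :=
          mul_le_mul_of_nonneg_right h3 (by positivity)
      _ = CE * (N ^ (M + 1))⁻¹ * Real.exp (ε * (N * ‖ξ‖) ^ (2 * μ) + (x * N * ξ.im +
          -(β * (N * ξ) ^ (2 * μ)).re)) := by rw [Real.exp_add, Real.exp_add]; ring
      _ ≤ _ := by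
          refine mul_le_mul_of_nonneg_left (Real.exp_le_exp.mpr ?_) (by positivity)
          linarith
  have hmain := hI N x y (CE * (N ^ (M + 1))⁻¹) Φ hN0 hy hxy hyB (by positivity) hΦd hΦb
  have hint : ∀ m : ℕ, IntervalIntegrable (fun θ : ℝ => ((N : ℂ) ^ m)⁻¹ *
      ((correctionPoly γ μ m).eval (N * (Complex.I * θ)) * kernel μ β x (N * θ)))
      MeasureTheory.volume (-δ) δ := fun m => by
    refine Continuous.intervalIntegrable (continuous_const.mul (Continuous.mul ?_ ?_)) _ _
    · exact (correctionPoly γ μ m).continuous.comp (by fun_prop)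
    · exact (continuous_kernel μ β x).comp (by fun_prop)
  have hTint : IntervalIntegrable (fun θ : ℝ => T θ * Kr θ) MeasureTheory.volume (-δ) δ := by
    refine Continuous.intervalIntegrable (Continuous.mul (hTc.comp (by fun_prop)) ?_) _ _
    simp only [hKr]
    fun_prop
  have hΦint : IntervalIntegrable (fun θ : ℝ => Φ θ) MeasureTheory.volume (-δ) δ := by
    refine ContinuousOn.intervalIntegrable fun θ hθ => ContinuousAt.continuousWithinAt ?_
    rw [Set.uIcc_of_le (by linarith)] at hθ
    have h1 := (hΦd θ (by simpa using abs_le.mpr hθ) (by simpa using hδ.le)).continuousAt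
    exact h1.comp (Complex.continuous_ofReal.continuousAt)
  have hsplit : ∫ θ in (-δ)..δ, f (θ : ℝ) ^ n * Complex.exp (-(Complex.I * l * (θ : ℝ))) =
      (∫ θ in (-δ)..δ, Φ (θ : ℝ)) + ∫ θ in (-δ)..δ, T (θ : ℝ) * Kr (θ : ℝ) := by
    rw [← intervalIntegral.integral_add hΦint hTint]
    refine intervalIntegral.integral_congr fun θ hθ => ?_
    rw [Set.uIcc_of_le (by linarith)] at hθ
    have h1 := (hballξ θ (hsmall θ (by simpa using abs_le.mpr hθ) (by simpa using hδ.le))).2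
    have h2 : Φ θ + T θ * Kr θ = Complex.exp ((N : ℂ) ^ (2 * μ) * R θ) * Kr θ := by
      simp only [hΦ]; ring
    rw [h2, h1, ← Complex.exp_nat_mul, hKr]
    simp only
    rw [← Complex.exp_add, ← Complex.exp_add, ← Complex.exp_add, mul_pow, hNnc]
    congr 1
    -- The phases `I α n θ` and `-I l θ` combine into `-I x (N θ)`.
    linear_combination (Complex.I * θ) * hxNc
  have hTsum : ∫ θ in (-δ)..δ, T (θ : ℝ) * Kr (θ : ℝ) = ∑ m ∈ Finset.range (M + 1),
      ((N : ℂ) ^ m)⁻¹ * ∫ θ in (-δ)..δ,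
        (correctionPoly γ μ m).eval (N * (Complex.I * (θ : ℝ))) * kernel μ β x (N * θ) := by
    simp_rw [← intervalIntegral.integral_const_mul]
    rw [← intervalIntegral.integral_finsetSum fun m _ => hint m]
    refine intervalIntegral.integral_congr fun θ _ => ?_
    simp only [hTdef, hKrk]
    rw [Finset.sum_mul]
    exact Finset.sum_congr rfl fun m _ => by ring
  have hrew : (1 / (2 * (Real.pi : ℂ))) * (∫ θ in (-δ)..δ,
        f (θ : ℝ) ^ n * Complex.exp (-(Complex.I * l * (θ : ℝ))))
      - ∑ m ∈ Finset.range (M + 1), ((N : ℂ) ^ (m + 1))⁻¹ *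
        applyNegDeriv (correctionPoly γ μ m) (attractor μ β) x =
      (1 / (2 * (Real.pi : ℂ))) * (∫ θ in (-δ)..δ, Φ (θ : ℝ)) -
      ∑ m ∈ Finset.range (M + 1), ((N : ℂ) ^ m)⁻¹ *
        ((N : ℂ)⁻¹ * applyNegDeriv (correctionPoly γ μ m) (attractor μ β) x -
        (1 / (2 * (Real.pi : ℂ))) * ∫ θ in (-δ)..δ,
          (correctionPoly γ μ m).eval (N * (Complex.I * (θ : ℝ))) * kernel μ β x (N * θ)) := by
    rw [hsplit, hTsum, mul_add, Finset.mul_sum, add_sub_assoc, ← Finset.sum_sub_distrib,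
      sub_eq_add_neg, ← Finset.sum_neg_distrib]
    congr 1
    refine Finset.sum_congr rfl fun m _ => ?_
    rw [pow_succ, mul_inv]
    ring
  have hexple : ∀ c', c ≤ c' → Real.exp (-(c' * y ^ (2 * μ))) ≤ Real.exp (-(c * y ^ (2 * μ))) :=
    fun c' h => Real.exp_le_exp.mpr
      (neg_le_neg (mul_le_mul_of_nonneg_right h (by positivity)))
  rw [hrew]
  set G := Real.exp (-(c * y ^ (2 * μ))) with hG
  have hb1 : ‖(1 / (2 * (Real.pi : ℂ))) * (∫ θ in (-δ)..δ, Φ (θ : ℝ))‖ ≤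
      CI * CE * ((N ^ (M + 2))⁻¹ * G) := by
    rw [norm_mul]
    calc _ ≤ 1 * (CI * (CE * (N ^ (M + 1))⁻¹) * N⁻¹ * G) := by
          refine mul_le_mul norm_one_div_two_pi_le (hmain.trans ?_) (norm_nonneg _) zero_le_one
          exact mul_le_mul_of_nonneg_left (hexple _ hcle.1) (by positivity)
      _ = _ := by rw [pow_succ N (M + 1), mul_inv]; ring
  have hb2 : ‖∑ m ∈ Finset.range (M + 1), ((N : ℂ) ^ m)⁻¹ *
        ((N : ℂ)⁻¹ * applyNegDeriv (correctionPoly γ μ m) (attractor μ β) x -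
        (1 / (2 * (Real.pi : ℂ))) * ∫ θ in (-δ)..δ,
          (correctionPoly γ μ m).eval (N * (Complex.I * (θ : ℝ))) * kernel μ β x (N * θ))‖ ≤
      (∑ m ∈ Finset.range (M + 1), CT m * CA m) * ((N ^ (M + 2))⁻¹ * G) := by
    rw [Finset.sum_mul]
    refine norm_sum_le_of_le _ fun m hm => ?_
    have h1 : ‖((N : ℂ) ^ m)⁻¹‖ ≤ 1 := by
      rw [norm_inv, norm_pow, Complex.norm_of_nonneg hN0.le]
      exact inv_le_one_of_one_le₀ (one_le_pow₀ hN)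
    rw [norm_mul]
    refine (mul_le_of_le_one_left (norm_nonneg _) h1).trans ((hT m N hN x).trans ?_)
    calc _ ≤ CT m * (CA m * (N ^ (M + 2))⁻¹ * G) := by
          refine mul_le_mul_of_nonneg_left ((hA m N y hN0 hy hyB).trans ?_) (hCT m).le
          exact mul_le_mul_of_nonneg_left (hexple _ (hcle.2 m hm))
            (mul_nonneg (hCA m).le (by positivity))
      _ = _ := by ring
  refine (norm_sub_le_of_le hb1 hb2).trans (le_of_eq ?_)
  ring

/-! ### Rescaled variables and the symbol near a tangency point. -/

theorem applyNegDeriv_one (H : ℝ → ℂ) (x : ℝ) : applyNegDeriv 1 H x = H x := by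
  rw [applyNegDeriv, ← Polynomial.C_1, Polynomial.sum_C_index] <;> simp

/-- The rescaled variables: `N = n ^ (1 / (2 μ))` and `y = |x| ^ (1 / (2 μ - 1))`. -/
theorem exists_scaling {μ : ℕ} (hμ : 0 < μ) (α : ℝ) (L : ℕ) :
    ∃ B : ℝ, 0 < B ∧ ∀ (n : ℕ) (l : ℤ), 1 ≤ n → |(l : ℝ)| ≤ (L : ℝ) * n →
      ∃ N y : ℝ, 1 ≤ N ∧ N ^ (2 * μ) = n ∧ rescaled α μ n l * N = l - α * n ∧ 0 ≤ y ∧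
        |rescaled α μ n l| = y ^ (2 * μ - 1) ∧ y ≤ B * N ∧
        y ^ (2 * μ) = |rescaled α μ n l| ^ (2 * (μ : ℝ) / (2 * (μ : ℝ) - 1)) ∧
        N = (n : ℝ) ^ (1 / (2 * (μ : ℝ))) ∧
        ∀ m : ℕ, N ^ m = (n : ℝ) ^ ((m : ℝ) / (2 * (μ : ℝ))) := by
  have hμ1 : (1 : ℝ) ≤ μ := by exact_mod_cast hμ
  -- `|l| ≤ L n` yields `y ^ (2 μ - 1) ≤ (L + |α|) * N ^ (2 μ - 1)`; the maximum with `1` ensures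
  -- `B₀ ≤ B₀ ^ (2 μ - 1)`.
  set B₀ : ℝ := max 1 (L + |α|) with hB₀
  have hB1 : 1 ≤ B₀ := le_max_left _ _
  refine ⟨B₀, by linarith, fun n l hn hl => ?_⟩
  have hn1 : (1 : ℝ) ≤ n := by exact_mod_cast hn
  have hn0 : (0 : ℝ) ≤ n := by linarith
  set N := (n : ℝ) ^ (1 / (2 * (μ : ℝ))) with hN
  set x := rescaled α μ n l with hx
  have hN1 : 1 ≤ N := Real.one_le_rpow hn1 (by positivity)
  have hN0 : 0 < N := by linarith
  have hNm : ∀ m : ℕ, N ^ m = (n : ℝ) ^ ((m : ℝ) / (2 * (μ : ℝ))) := fun m => by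
    rw [hN, ← Real.rpow_mul_natCast hn0]
    congr 1
    ring
  have hNn : N ^ (2 * μ) = n := by
    rw [hNm]
    push_cast
    rw [div_self (by positivity), Real.rpow_one]
  have hxN : x * N = l - α * n := by
    rw [hx, rescaled, ← hN, div_mul_cancel₀ _ hN0.ne']
  have hsub : ((2 * μ - 1 : ℕ) : ℝ) = 2 * (μ : ℝ) - 1 := by
    rw [Nat.cast_sub (by omega)]; push_cast; ring
  have hpos : (0 : ℝ) < 2 * (μ : ℝ) - 1 := by linarith
  have hy : |x| = (|x| ^ (1 / (2 * (μ : ℝ) - 1))) ^ (2 * μ - 1) := by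
    rw [← Real.rpow_mul_natCast (abs_nonneg x), hsub, one_div_mul_cancel hpos.ne', Real.rpow_one]
  refine ⟨N, |x| ^ (1 / (2 * (μ : ℝ) - 1)), hN1, hNn, hxN, by positivity, hy, ?_, ?_, rfl, hNm⟩
  · have hne : 2 * μ - 1 ≠ 0 := by omega
    rw [← pow_le_pow_iff_left₀ (by positivity) (by positivity) hne, ← hy]
    have h1 : |x| * N ≤ B₀ * N ^ (2 * μ) := by
      rw [← abs_of_pos hN0, ← abs_mul, abs_of_pos hN0, hxN, hNn]
      have h2 : |(l : ℝ) - α * n| ≤ |(l : ℝ)| + |α| * n := by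
        refine (abs_sub _ _).trans ?_
        rw [abs_mul, abs_of_nonneg hn0]
      have h3 : (L + |α|) * n ≤ B₀ * n := mul_le_mul_of_nonneg_right (le_max_right _ _) hn0
      linarith
    have h4 : N ^ (2 * μ) = N ^ (2 * μ - 1) * N := by
      rw [← pow_succ]; congr 1; omega
    rw [h4, ← mul_assoc] at h1
    have h5 := le_of_mul_le_mul_right h1 hN0
    rw [mul_pow]
    refine h5.trans (mul_le_mul_of_nonneg_right ?_ (by positivity))
    exact le_self_pow₀ hB1 hne
  · rw [← Real.rpow_mul_natCast (abs_nonneg x)]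
    congr 1
    push_cast
    ring

/-- The Fourier series is uniformly smaller than one away from the tangency points. -/
theorem exists_norm_fourierSum_le {a : ℤ → ℂ} {K : ℕ} {κ : Fin K → ℂ}
    (hc : ContinuousOn (fourierSum a) (Metric.sphere (0 : ℂ) 1))
    (hlt : ∀ z : ℂ, ‖z‖ = 1 → z ∉ Set.range κ → ‖fourierSum a z‖ < 1) {ρ : ℝ} (hρ : 0 < ρ) :
    ∃ q : ℝ, 0 < q ∧ q < 1 ∧
      ∀ z : ℂ, ‖z‖ = 1 → (∀ k, ρ ≤ ‖z - κ k‖) → ‖fourierSum a z‖ ≤ q := by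
  set Z : Set ℂ := Metric.sphere (0 : ℂ) 1 ∩ ⋂ k, {z : ℂ | ρ ≤ ‖z - κ k‖} with hZ
  have hZc : IsCompact Z := (isCompact_sphere 0 1).inter_right
    (isClosed_iInter fun k => isClosed_le continuous_const (by fun_prop))
  have hmem : ∀ z : ℂ, z ∈ Z ↔ ‖z‖ = 1 ∧ ∀ k, ρ ≤ ‖z - κ k‖ := fun z => by
    simp [hZ]
  rcases Z.eq_empty_or_nonempty with h | h
  · refine ⟨1 / 2, by norm_num, by norm_num, fun z h1 h2 => ?_⟩
    have : z ∈ Z := (hmem z).mpr ⟨h1, h2⟩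
    simp [h] at this
  · obtain ⟨z₀, hz₀, hmax⟩ := hZc.exists_isMaxOn h (hc.mono Set.inter_subset_left).norm
    have h0 := (hmem z₀).mp hz₀
    have hq : ‖fourierSum a z₀‖ < 1 := hlt z₀ h0.1 (by
      rintro ⟨k, rfl⟩
      have := h0.2 k
      simp at this
      linarith)
    -- The maximum with `1 / 2` keeps `q` positive, so that `q ^ n` can be written with `Real.log
    -- q`.
    refine ⟨max (1 / 2) ‖fourierSum a z₀‖, lt_max_of_lt_left (by norm_num),
      max_lt (by norm_num) hq, fun z h1 h2 => ?_⟩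
    exact (hmax ((hmem z).mpr ⟨h1, h2⟩)).trans (le_max_right _ _)

/-- The normalized Fourier series near a tangency point. -/
noncomputable def localSymbol (a : ℤ → ℂ) (κ ξ : ℂ) : ℂ :=
  fourierSum a (κ * Complex.exp (Complex.I * ξ)) / fourierSum a κ

theorem fourierSum_pow_mul_zpow_eq (a : ℤ → ℂ) {κ : ℂ} (hF : fourierSum a κ ≠ 0) (n : ℕ) (l : ℤ)
    (θ : ℝ) :
    fourierSum a (κ * Complex.exp (θ * Complex.I)) ^ n *
      (κ * Complex.exp (θ * Complex.I)) ^ (-l) =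
      κ ^ (-l) * fourierSum a κ ^ n *
        (localSymbol a κ θ ^ n * Complex.exp (-(Complex.I * l * (θ : ℝ)))) := by
  have h1 : Complex.exp (θ * Complex.I) ^ (-l) = Complex.exp (-(Complex.I * l * (θ : ℝ))) := by
    rw [← Complex.exp_int_mul]
    push_cast
    ring_nf
  rw [mul_zpow, h1, localSymbol, mul_comm Complex.I, div_pow]
  field_simp

theorem sum_range_eq_add_sum_Icc {E : Type*} [AddCommMonoid E] (u : ℕ → E) (M : ℕ) :
    ∑ m ∈ Finset.range (M + 1), u m = u 0 + ∑ m ∈ Finset.Icc 1 M, u m := by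
  rw [Finset.range_eq_Ico, Finset.sum_eq_sum_Ico_succ_bot (Nat.succ_pos M)]
  rfl

theorem NormalizedHolomorphic.summable_norm {a : ℤ → ℂ} (ha : NormalizedHolomorphic a) :
    Summable fun l => ‖a l‖ := by
  simpa using ha.mem_l1.summable (by simp)

theorem NormalizedHolomorphic.analyticAt {a : ℤ → ℂ} (ha : NormalizedHolomorphic a) {z : ℂ}
    (hz : ‖z‖ = 1) : AnalyticAt ℂ (fourierSum a) z := by
  obtain ⟨ε, hε, -, hd⟩ := ha.holomorphic
  refine hd.analyticAt (IsOpen.mem_nhds ?_ ?_)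
  · exact (isOpen_lt continuous_const continuous_norm).inter
      (isOpen_lt continuous_norm continuous_const)
  · constructor <;> linarith

theorem NormalizedHolomorphic.exists_weight {a : ℤ → ℂ} (ha : NormalizedHolomorphic a) :
    ∃ r : ℝ, 1 < r ∧ (Summable fun l : ℤ => ‖a l‖ * r ^ l) ∧
      Summable fun l : ℤ => ‖a l‖ * r⁻¹ ^ l := by
  obtain ⟨ε, hε, hs, -⟩ := ha.holomorphic
  set e := ε / 2 with he
  have he0 : 0 < e := half_pos hε
  have hr : 0 < 1 + e := by linarith
  refine ⟨1 + e, by linarith, summable_norm_mul_zpow hr (hs _ ?_ ?_),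
    summable_norm_mul_zpow (inv_pos.mpr hr) (hs _ ?_ ?_)⟩
  · rw [Complex.norm_of_nonneg hr.le]; linarith
  · rw [Complex.norm_of_nonneg hr.le]; linarith
  · rw [Complex.norm_of_nonneg (inv_pos.mpr hr).le, ← one_div, lt_div_iff₀ hr]
    nlinarith
  · rw [Complex.norm_of_nonneg (inv_pos.mpr hr).le]
    have : (1 + e)⁻¹ < 1 := inv_lt_one_of_one_lt₀ (by linarith)
    linarith

/-- The local approximation at one tangency point, in the variables of the statement. -/
theorem exists_tangency_bound {a : ℤ → ℂ} (ha : NormalizedHolomorphic a) {K : ℕ} {κ : Fin K → ℂ}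
    {α : Fin K → ℝ} {β : Fin K → ℂ} {μ : Fin K → ℕ} (hT : TangencyData a κ α β μ) (M : ℕ)
    (k : Fin K) :
    ∃ δ₀ : ℝ, 0 < δ₀ ∧ ∀ δ : ℝ, 0 < δ → δ ≤ δ₀ → ∀ L : ℕ,
      ∃ C : ℝ, 0 < C ∧ ∃ c : ℝ, 0 < c ∧ ∀ (n : ℕ) (l : ℤ), 1 ≤ n → |(l : ℝ)| ≤ (L : ℝ) * n →
        ‖(1 / (2 * (Real.pi : ℂ))) * (∫ θ in (-δ)..δ,
            localSymbol a (κ k) (θ : ℝ) ^ n * Complex.exp (-(Complex.I * l * (θ : ℝ))))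
          - (attractor (μ k) (β k) (rescaled (α k) (μ k) n l)
              / (((n : ℝ) ^ (1 / (2 * (μ k : ℝ))) : ℝ) : ℂ)
            + ∑ m ∈ Finset.Icc 1 M, applyNegDeriv (correctionPoly (cumulant a (κ k)) (μ k) m)
                (attractor (μ k) (β k)) (rescaled (α k) (μ k) n l)
                / (((n : ℝ) ^ (((m : ℝ) + 1) / (2 * (μ k : ℝ))) : ℝ) : ℂ))‖ ≤
          C * (1 / (n : ℝ) ^ (((M : ℝ) + 2) / (2 * (μ k : ℝ)))
              * Real.exp (-c * |rescaled (α k) (μ k) n l|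
                  ^ (2 * (μ k : ℝ) / (2 * (μ k : ℝ) - 1)))) := by
  have hF : fourierSum a (κ k) ≠ 0 := fun h => by
    have := hT.norm_value k
    rw [h, norm_zero] at this
    exact zero_ne_one this
  have hf0 : localSymbol a (κ k) 0 = 1 := by
    simp [localSymbol, hF]
  have hf : AnalyticAt ℂ (localSymbol a (κ k)) 0 := by
    have h1 : AnalyticAt ℂ (fourierSum a) ((fun ξ : ℂ => κ k * Complex.exp (Complex.I * ξ)) 0) := by
      simpa using ha.analyticAt (hT.norm_point k)
    have h2 : AnalyticAt ℂ (fun ξ : ℂ => κ k * Complex.exp (Complex.I * ξ)) 0 := by fun_prop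
    exact (AnalyticAt.comp (f := fun ξ : ℂ => κ k * Complex.exp (Complex.I * ξ)) h1 h2).div analyticAt_const hF
  have hexp : ∃ R : ℂ → ℂ, (R =O[𝓝 0] fun ξ : ℂ => ξ ^ (2 * μ k + 1)) ∧ ∀ᶠ ξ : ℂ in 𝓝 0,
      localSymbol a (κ k) ξ =
        Complex.exp (Complex.I * α k * ξ - β k * ξ ^ (2 * μ k) + R ξ) := by
    obtain ⟨R, hR, h⟩ := hT.expansion k
    refine ⟨R, hR, h.mono fun ξ hξ => ?_⟩
    rw [localSymbol, hξ, mul_div_cancel_left₀ _ hF]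
  obtain ⟨δ₀, hδ₀, hloc⟩ := exists_norm_local_sub_le (hT.mu_pos k) hf hf0 (hT.re_pos k) hexp
    (γ := cumulant a (κ k)) (fun ν => rfl) M
  refine ⟨δ₀, hδ₀, fun δ hδ hδle L => ?_⟩
  obtain ⟨B, hB, hscale⟩ := exists_scaling (hT.mu_pos k) (α k) L
  obtain ⟨C, hC, c, hc, hb⟩ := hloc δ hδ hδle B hB
  refine ⟨C, hC, c, hc, fun n l hn hl => ?_⟩
  obtain ⟨N, y, hN1, hNn, hxN, hy0, hxy, hyB, hyp, hN, hNm⟩ := hscale n l hn hl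
  have h := hb n l N _ y hN1 hNn hxN hy0 hxy hyB
  have e1 : (N ^ (M + 2))⁻¹ = 1 / (n : ℝ) ^ (((M : ℝ) + 2) / (2 * (μ k : ℝ))) := by
    rw [hNm, one_div]; push_cast; rfl
  rw [sum_range_eq_add_sum_Icc, correctionPoly_zero, applyNegDeriv_one, e1, hyp, zero_add, pow_one,
    mul_assoc C, ← neg_mul, hN, inv_mul_eq_div] at h
  convert h using 6 with m hm
  rw [inv_mul_eq_div, ← Complex.ofReal_pow, ← hN, hNm]
  push_cast
  rfl

end ConvPower

/-! ### Assembly over all tangency points. -/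

theorem theorem1 (a : ℤ → ℂ) (ha : NormalizedHolomorphic a)
    (K : ℕ) (κ : Fin K → ℂ) (α : Fin K → ℝ) (β : Fin K → ℂ) (μ : Fin K → ℕ)
    (hT : TangencyData a κ α β μ) :
    ∃ L : ℕ, 0 < L ∧ ∃ c₀ : ℝ, 0 < c₀ ∧
      (∀ n : ℕ, 1 ≤ n → ∀ l : ℤ, (L : ℝ) * (n : ℝ) < |(l : ℝ)| →
        ‖convPow a n l‖ ≤ Real.exp (-c₀ * (n : ℝ) - c₀ * |(l : ℝ)|)) ∧
      (∀ M : ℕ, ∃ C c : ℝ, 0 < C ∧ 0 < c ∧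
        ∀ n : ℕ, 1 ≤ n → ∀ l : ℤ, |(l : ℝ)| ≤ (L : ℝ) * (n : ℝ) →
          ‖convPow a n l
            - ∑ k : Fin K, κ k ^ (-l) * fourierSum a (κ k) ^ n
                / (((n : ℝ) ^ (1 / (2 * (μ k : ℝ))) : ℝ) : ℂ)
                * attractor (μ k) (β k) (rescaled (α k) (μ k) n l)
            - ∑ k : Fin K, ∑ m ∈ Finset.Icc 1 M, κ k ^ (-l) * fourierSum a (κ k) ^ n
                / (((n : ℝ) ^ (((m : ℝ) + 1) / (2 * (μ k : ℝ))) : ℝ) : ℂ)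
                * applyNegDeriv (correctionPoly (cumulant a (κ k)) (μ k) m)
                    (attractor (μ k) (β k)) (rescaled (α k) (μ k) n l)‖
          ≤ C * ∑ k : Fin K, 1 / (n : ℝ) ^ (((M : ℝ) + 2) / (2 * (μ k : ℝ)))
              * Real.exp (-c * |rescaled (α k) (μ k) n l|
                  ^ (2 * (μ k : ℝ) / (2 * (μ k : ℝ) - 1)))) := by
  obtain ⟨r, hr, hr1, hr2⟩ := ha.exists_weight
  obtain ⟨L, hL, c₀, hc₀, hcone⟩ := exists_cone hr hr1 hr2
  refine ⟨L, hL, c₀, hc₀, hcone, fun M => ?_⟩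
  have hF : ∀ k, fourierSum a (κ k) ≠ 0 := fun k h => by
    have := hT.norm_value k
    rw [h, norm_zero] at this
    exact zero_ne_one this
  have hcs : ContinuousOn (fourierSum a) (Metric.sphere (0 : ℂ) 1) := fun z hz =>
    (ha.analyticAt (by simpa using hz)).continuousAt.continuousWithinAt
  choose δ₀ hδ₀ hloc using exists_tangency_bound ha hT M
  obtain ⟨δ, ⟨⟨hδle, hδπ⟩, hsep⟩, hδ⟩ : ∃ δ : ℝ, (((∀ k, δ ≤ δ₀ k) ∧ δ < Real.pi) ∧
      ∀ j k, j ≠ k → 2 * δ < ‖κ j - κ k‖) ∧ 0 < δ := by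
    have h1 : ∀ᶠ δ : ℝ in 𝓝[>] 0, ∀ k, δ ≤ δ₀ k := eventually_all.mpr fun k =>
      nhdsWithin_le_nhds ((eventually_lt_nhds (hδ₀ k)).mono fun _ h => h.le)
    have h2 : ∀ᶠ δ : ℝ in 𝓝[>] 0, δ < Real.pi :=
      nhdsWithin_le_nhds (eventually_lt_nhds Real.pi_pos)
    have h3 : ∀ᶠ δ : ℝ in 𝓝[>] 0, ∀ j k, j ≠ k → 2 * δ < ‖κ j - κ k‖ := by
      refine eventually_all.mpr fun j => eventually_all.mpr fun k => ?_
      by_cases hjk : j = k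
      · simp [hjk]
      · have hpos : 0 < ‖κ j - κ k‖ := norm_pos_iff.mpr (sub_ne_zero.mpr (hT.injective.ne hjk))
        have : ∀ᶠ δ : ℝ in 𝓝[>] 0, δ < ‖κ j - κ k‖ / 2 :=
          nhdsWithin_le_nhds (eventually_lt_nhds (half_pos hpos))
        exact this.mono fun δ h _ => by linarith
    exact (((h1.and h2).and h3).and self_mem_nhdsWithin).exists
  obtain ⟨q, hq0, hq1, hq⟩ := exists_norm_fourierSum_le hcs hT.norm_lt
    (show 0 < 2 * δ / Real.pi by positivity)
  choose C hC c hc hb using fun k => hloc k δ hδ (hδle k) L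
  -- The far part of the circle belongs to no tangency point; its error `q ^ n` is charged to this
  -- one, which exists because `1 ≤ K`.
  set k₀ : Fin K := ⟨0, hT.one_le⟩
  obtain ⟨B, hB, hscale⟩ := exists_scaling (hT.mu_pos k₀) (α k₀) L
  obtain ⟨C', hC', c', hc', habs⟩ := exists_exp_le_absorb
    (neg_pos.mpr (Real.log_neg hq0 hq1)) hB (hT.mu_pos k₀) (M + 2)
  obtain ⟨d, hd, hdc', hdc⟩ : ∃ d : ℝ, 0 < d ∧ d ≤ c' ∧ ∀ k, d ≤ c k := by
    obtain ⟨k₁, -, hk₁⟩ := Finset.exists_min_image Finset.univ c ⟨k₀, Finset.mem_univ _⟩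
    exact ⟨min c' (c k₁), lt_min hc' (hc k₁), min_le_left _ _,
      fun k => (min_le_right _ _).trans (hk₁ k (Finset.mem_univ _))⟩
  have hsum0 : 0 ≤ ∑ k, C k := Finset.sum_nonneg fun k _ => (hC k).le
  refine ⟨C' + ∑ k, C k, d, by linarith, hd, fun n hn l hl => ?_⟩
  set G : ℝ → Fin K → ℝ := fun s k => 1 / (n : ℝ) ^ (((M : ℝ) + 2) / (2 * (μ k : ℝ)))
    * Real.exp (-s * |rescaled (α k) (μ k) n l| ^ (2 * (μ k : ℝ) / (2 * (μ k : ℝ) - 1))) with hG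
  have hG0 : ∀ k, 0 ≤ G d k := fun k => by simp only [hG]; positivity
  have hGle : ∀ s k, d ≤ s → G s k ≤ G d k := fun s k hs => by
    simp only [hG]
    refine mul_le_mul_of_nonneg_left (Real.exp_le_exp.mpr ?_) (by positivity)
    exact mul_le_mul_of_nonneg_right (neg_le_neg hs) (by positivity)
  have hGsum : ∀ k, G d k ≤ ∑ k, G d k := fun k =>
    Finset.single_le_sum (fun j _ => hG0 j) (Finset.mem_univ k)
  set I : Fin K → ℂ := fun k => ∫ θ in (-δ)..δ,
    localSymbol a (κ k) (θ : ℝ) ^ n * Complex.exp (-(Complex.I * l * (θ : ℝ))) with hI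
  set A : Fin K → ℂ := fun k => attractor (μ k) (β k) (rescaled (α k) (μ k) n l)
      / (((n : ℝ) ^ (1 / (2 * (μ k : ℝ))) : ℝ) : ℂ)
    + ∑ m ∈ Finset.Icc 1 M, applyNegDeriv (correctionPoly (cumulant a (κ k)) (μ k) m)
        (attractor (μ k) (β k)) (rescaled (α k) (μ k) n l)
        / (((n : ℝ) ^ (((m : ℝ) + 1) / (2 * (μ k : ℝ))) : ℝ) : ℂ) with hA
  set w : Fin K → ℂ := fun k => κ k ^ (-l) * fourierSum a (κ k) ^ n with hw
  have hw1 : ∀ k, ‖w k‖ = 1 := fun k => by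
    simp [hw, hT.norm_point k, hT.norm_value k]
  have hlocal : ∀ k, ‖(1 / (2 * (Real.pi : ℂ))) * I k - A k‖ ≤ C k * G d k := fun k =>
    (hb k n l hn hl).trans (mul_le_mul_of_nonneg_left (hGle _ k (hdc k)) (hC k).le)
  have hfar : ‖convPow a n l - ∑ k, w k * ((1 / (2 * (Real.pi : ℂ))) * I k)‖ ≤ C' * G d k₀ := by
    have hcont : Continuous fun θ : ℝ => fourierSum a (Complex.exp (θ * Complex.I)) ^ n *
        Complex.exp (θ * Complex.I) ^ (-l) := by
      refine Continuous.mul (Continuous.pow ?_ n) (Continuous.zpow₀ (by fun_prop) _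
        fun θ => Or.inl (Complex.exp_ne_zero _))
      exact hcs.comp_continuous (by fun_prop) fun θ => by
        simp [Complex.norm_exp_ofReal_mul_I]
    have h1 := norm_integral_sub_sum_arcs_le (h := fun z => fourierSum a z ^ n * z ^ (-l))
      hT.norm_point hδ hδπ hsep hcont (q := q ^ n) (by positivity) (fun z hz1 hz2 => by
        rw [norm_mul, norm_zpow, hz1, one_zpow, mul_one, norm_pow]
        exact pow_le_pow_left₀ (norm_nonneg _) (hq z hz1 hz2) n)
    rw [integral_fourierSum_pow_mul_zpow ha.summable_norm hn l] at h1
    have h2 : ∀ k, ∫ θ in (-δ)..δ, fourierSum a (κ k * Complex.exp (θ * Complex.I)) ^ n *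
        (κ k * Complex.exp (θ * Complex.I)) ^ (-l) = w k * I k := fun k => by
      simp only [hI, hw]
      rw [← intervalIntegral.integral_const_mul]
      exact intervalIntegral.integral_congr fun θ _ => fourierSum_pow_mul_zpow_eq a (hF k) n l θ
    simp only [h2] at h1
    have hpi : (Real.pi : ℂ) ≠ 0 := by exact_mod_cast Real.pi_ne_zero
    have h3 : 2 * (Real.pi : ℂ) * convPow a n l - ∑ k, w k * I k =
        2 * (Real.pi : ℂ) *
          (convPow a n l - ∑ k, w k * ((1 / (2 * (Real.pi : ℂ))) * I k)) := by
      rw [mul_sub, Finset.mul_sum]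
      congr 1
      refine Finset.sum_congr rfl fun k _ => ?_
      field_simp
    rw [h3, norm_mul, norm_mul, Complex.norm_ofNat, Complex.norm_of_nonneg Real.pi_pos.le] at h1
    have h4 := le_of_mul_le_mul_left h1 (by positivity)
    obtain ⟨N, y, hN1, hNn, -, hy0, -, hyB, hyp, -, hNm⟩ := hscale n l hn hl
    have h5 := habs N y (by linarith) hy0 hyB
    have h6 : q ^ n = Real.exp (-(-Real.log q * N ^ (2 * μ k₀))) := by
      rw [hNn, neg_mul, neg_neg, mul_comm, Real.exp_nat_mul, Real.exp_log hq0]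
    have h7 : C' * (N ^ (M + 2))⁻¹ * Real.exp (-(c' * y ^ (2 * μ k₀))) = C' * G c' k₀ := by
      simp only [hG]
      rw [hNm, hyp, one_div, mul_assoc, neg_mul]
      push_cast
      rfl
    rw [h7, ← h6] at h5
    exact h4.trans (h5.trans (mul_le_mul_of_nonneg_left (hGle _ _ hdc') hC'.le))
  have hrew : convPow a n l
            - ∑ k : Fin K, κ k ^ (-l) * fourierSum a (κ k) ^ n
                / (((n : ℝ) ^ (1 / (2 * (μ k : ℝ))) : ℝ) : ℂ)
                * attractor (μ k) (β k) (rescaled (α k) (μ k) n l)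
            - ∑ k : Fin K, ∑ m ∈ Finset.Icc 1 M, κ k ^ (-l) * fourierSum a (κ k) ^ n
                / (((n : ℝ) ^ (((m : ℝ) + 1) / (2 * (μ k : ℝ))) : ℝ) : ℂ)
                * applyNegDeriv (correctionPoly (cumulant a (κ k)) (μ k) m)
                    (attractor (μ k) (β k)) (rescaled (α k) (μ k) n l) =
      (convPow a n l - ∑ k, w k * ((1 / (2 * (Real.pi : ℂ))) * I k)) +
        ∑ k, w k * ((1 / (2 * (Real.pi : ℂ))) * I k - A k) := by
    have h1 : ∀ k, w k * ((1 / (2 * (Real.pi : ℂ))) * I k - A k) =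
        w k * ((1 / (2 * (Real.pi : ℂ))) * I k) - (κ k ^ (-l) * fourierSum a (κ k) ^ n
                / (((n : ℝ) ^ (1 / (2 * (μ k : ℝ))) : ℝ) : ℂ)
                * attractor (μ k) (β k) (rescaled (α k) (μ k) n l) +
          ∑ m ∈ Finset.Icc 1 M, κ k ^ (-l) * fourierSum a (κ k) ^ n
                / (((n : ℝ) ^ (((m : ℝ) + 1) / (2 * (μ k : ℝ))) : ℝ) : ℂ)
                * applyNegDeriv (correctionPoly (cumulant a (κ k)) (μ k) m)
                    (attractor (μ k) (β k)) (rescaled (α k) (μ k) n l)) := fun k => by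
      simp only [hA]
      rw [mul_sub, mul_add, Finset.mul_sum]
      congr 2
      · simp only [hw]; ring
      · exact Finset.sum_congr rfl fun m _ => by simp only [hw]; ring
    rw [Finset.sum_congr rfl fun k _ => h1 k, Finset.sum_sub_distrib, Finset.sum_add_distrib]
    ring
  rw [hrew]
  have hsumle : ‖∑ k, w k * ((1 / (2 * (Real.pi : ℂ))) * I k - A k)‖ ≤
      (∑ k, C k) * ∑ k, G d k := by
    rw [Finset.sum_mul]
    refine norm_sum_le_of_le _ fun k _ => ?_
    rw [norm_mul, hw1, one_mul]
    exact (hlocal k).trans (mul_le_mul_of_nonneg_left (hGsum k) (hC k).le)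
  refine (norm_add_le_of_le (hfar.trans (mul_le_mul_of_nonneg_left (hGsum k₀) hC'.le))
    hsumle).trans (le_of_eq ?_)
  rw [← add_mul]
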